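/- Let $m,k\ge 0$ be integers, $n=2(k+m+2)+1$, and let $G=\mathrm{UT}(n,\mathbb R)$ be the group of real upper triangular $n\times n$ matrices with units on the diagonal, with its usual (Lie group) topology and Lie algebra $\mathfrak g$ of strictly upper triangular matrices. A strictly lower triangular matrix $f$ is identified with the linear form $x\mapsto\operatorname{tr}(fx)$ on $\mathfrak g$; $G^f$ is its stabilizer under the coadjoint action, and $\mathrm{Ad}_G(G^f)=\{hxh^{-1}: h\in G,\ x\in G^f\}$. Partition rows and columns into nine blocks of sizes $(m,1,1,k,1,k,1,1,m)$ and write $C_{ij}$ for the blocks of the general element $g\in G$. Let $f$ be the matrix whose only nonzero blocks are $f_{91}=\Lambda_1$, $f_{64}=\Lambda_2$, $f_{72}=\gamma_1$, $f_{83}=\gamma_2$, $f_{87}=\gamma_3$, where $\Lambda_1$ (of size $m$) and $\Lambda_2$ (of size $k$) have nonzero entries on the second diagonal (from the lower left to the upper right corner) and zeros elsewhere, $\gamma_1,\gamma_2\in\mathbb R\setminus\{0\}$ and $\gamma_3\in\mathbb R$. Let $\mathbb R'[G]$ be the localization of the algebra $\mathbb R[G]$ of regular functions on $G$ by the powers of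 $d_1(g)=\det C_{23}\cdot\det C_{46}\cdot\det C_{78}$, and $\Phi'=\{(2,3),(4,6),(7,8)\}$. For an entry $c$ of the block $C_{ij}$ let $\Phi'(c)$ be the set of all $(a,b)\in\Phi'$ with $a>i$ and $b<j$, let $\Delta(c)$ be the minor of $g$ whose rows are those of the row blocks $a$ and whose columns are those of the column blocks $b$, $(a,b)\in\Phi'(c)$ (an invertible element of $\mathbb R'[G]$), let $\tilde\Delta(c)$ be the minor obtained by adding the row and the column of $c$, and put $\tilde c=\pm\Delta(c)^{-1}\tilde\Delta(c)\in\mathbb R'[G]$, where $\pm$ is the sign of the entry $c$ in $\tilde\Delta(c)$. Let $S=S_0\cup S_1\cup S_2$, where 1) $S_0$ is the set of the entries above the diagonal in the blocks $C_{11},C_{44},C_{66},C_{99}$; 2) $S_1$ is the set of all $\tilde c$, where $c$ runs through the entries of the blocks $C_{12}$, $C_{14}$, $C_{15}$, $C_{17}$, $C_{34}$, $C_{35}$, $C_{37}$, $C_{39}$, $C_{45}$, $C_{56}$, $C_{57}$, $C_{59}$, $C_{67}$, $C_{69}$, $C_{89}$; 3) $S_2$ consists of the entries of $C_{23}C_{36}+C_{24}C_{46}$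 and of $C_{46}C_{68}+C_{47}C_{78}$, and of $\gamma_1C_{23}-\gamma_2C_{78}$. Let $I'$ be the ideal of $\mathbb R'[G]$ generated by $S$, and let $\mathrm{Ann}(I')$ be its zero set, that is, the set of all $g\in G$ with $d_1(g)\ne0$ at which all elements of $I'$ vanish. Then the closure of $\mathrm{Ann}(I')$ in $G$ coincides with the closure of $\mathrm{Ad}_G(G^f)$ in $G$. -/

import Mathlib

open scoped Matrix

noncomputable section

namespace Subregular

section General

variable (ι : Type) [Fintype ι] [LinearOrder ι]

/-- The real unitriangular group on a finite linearly ordered index set: upper triangular matrices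
with units on the diagonal. It carries the subspace topology of the space of matrices. -/
def UT : Subgroup (Matrix.SpecialLinearGroup ι ℝ) where
  carrier := {g | (∀ i, g.1 i i = 1) ∧ ∀ i j, j < i → g.1 i j = 0}
  mul_mem' := by
    rintro a b ⟨ha, ha'⟩ ⟨hb, hb'⟩
    refine ⟨fun i => ?_, fun i j hij => ?_⟩
    · rw [Matrix.SpecialLinearGroup.coe_mul, Matrix.mul_apply, Finset.sum_eq_single i]
      · rw [ha, hb, one_mul]
      · intro j _ hj
        rcases lt_or_gt_of_ne hj with h | h
        · rw [ha' i j h, zero_mul]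
        · rw [hb' j i h, mul_zero]
      · simp
    · rw [Matrix.SpecialLinearGroup.coe_mul, Matrix.mul_apply]
      refine Finset.sum_eq_zero fun l _ => ?_
      rcases lt_or_ge l i with h | h
      · rw [ha' i l h, zero_mul]
      · rw [hb' l j (lt_of_lt_of_le hij h), mul_zero]
  one_mem' := ⟨fun i => by simp, fun i j hij => by simp [hij.ne']⟩
  inv_mem' := by
    rintro a ⟨ha, ha'⟩
    have hmul : a.1 * (a⁻¹).1 = 1 := by
      rw [← Matrix.SpecialLinearGroup.coe_mul, mul_inv_cancel, Matrix.SpecialLinearGroup.coe_one]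
    have hinv : (a⁻¹).1 = a.1⁻¹ := (Matrix.inv_eq_right_inv hmul).symm
    have hlow : ∀ i j, j < i → (a⁻¹).1 i j = 0 := by
      intro i j hij
      let _ : Invertible a.1 := invertibleOfRightInverse _ _ hmul
      have hb : Matrix.BlockTriangular a.1 (id : ι → ι) := fun i j h => ha' i j h
      rw [hinv]
      exact Matrix.blockTriangular_inv_of_blockTriangular hb hij
    refine ⟨fun i => ?_, hlow⟩
    have h := congrFun (congrFun hmul i) i
    rw [Matrix.mul_apply, Finset.sum_eq_single i, ha, one_mul, Matrix.one_apply_eq] at h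
    · exact h
    · intro j _ hj
      rcases lt_or_gt_of_ne hj with h' | h'
      · rw [ha' i j h', zero_mul]
      · rw [hlow j i h', mul_zero]
    · simp

variable {ι}

/-- The underlying matrix of an element of the unitriangular group. -/
def mat (g : UT ι) : Matrix ι ι ℝ := g.1.1

variable (ι)

/-- The Lie algebra of the unitriangular group: strictly upper triangular matrices. -/
def ut : Submodule ℝ (Matrix ι ι ℝ) where
  carrier := {x | ∀ i j, j ≤ i → x i j = 0}
  add_mem' := fun {a b} ha hb i j h => by simp [ha i j h, hb i j h]
  zero_mem' := fun _ _ _ => rfl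
  smul_mem' := fun c a ha i j h => by simp [ha i j h]

variable {ι}

/-- The stabilizer `G^f` for the coadjoint action, where a strictly lower triangular matrix `f` is
identified with the linear form `x ↦ tr (f x)` on the Lie algebra, and the coadjoint action is
`(g • f) x = f (g⁻¹ x g)`. -/
def coadStabilizer (f : Matrix ι ι ℝ) : Set (UT ι) :=
  {g | ∀ x ∈ ut ι, Matrix.trace (f * (mat g⁻¹ * x * mat g)) = Matrix.trace (f * x)}

/-- `Ad_G (A)`: the union of the conjugates `h A h⁻¹` of a subset `A` of the group. -/
def conjSaturation (A : Set (UT ι)) : Set (UT ι) :=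
  {g | ∃ h : UT ι, ∃ x ∈ A, g = h * x * h⁻¹}

variable (ι)

/-- The algebra `ℝ[G]` of regular functions on the unitriangular group: as a variety the group is
the affine space whose coordinates are the matrix entries above the diagonal. -/
abbrev RegFun : Type := MvPolynomial {p : ι × ι // p.1 < p.2} ℝ

/-- The general element of the unitriangular group: the matrix of coordinate functions. -/
def genericMat : Matrix ι ι (RegFun ι) := fun i j =>
  if h : i < j then MvPolynomial.X ⟨(i, j), h⟩ else if i = j then 1 else 0

variable {ι}

/-- The value of regular functions at an element of the group. -/
def evalAt (g : UT ι) : RegFun ι →+* ℝ :=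
  (MvPolynomial.aeval fun p : {p : ι × ι // p.1 < p.2} => mat g p.1.1 p.1.2).toRingHom

/-- The zero set of an ideal `I` of the localization `ℝ[G]_d`: the set of those `g` in
`{g ∈ G | d g ≠ 0}` at which all elements of `I` vanish. -/
def zeroSet (d : RegFun ι) (I : Ideal (Localization.Away d)) : Set (UT ι) :=
  {g | ∃ hd : evalAt g d ≠ 0, ∀ φ ∈ I,
    IsLocalization.Away.lift (S := Localization.Away d) d (g := evalAt g) hd.isUnit φ = 0}

end General

section Odd

/-- The partition `(m, 1, 1, k, 1, k, 1, 1, m)` of `n = 2 (k + m + 2) + 1`. The nine blocks are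
numbered from `0` to `8`. -/
def size (m k : ℕ) : Fin 9 → ℕ := ![m, 1, 1, k, 1, k, 1, 1, m]

/-- The set of the `n = 2 (k + m + 2) + 1` row and column indices: pairs (block, place in the block)
in the lexicographic order. -/
abbrev Idx (m k : ℕ) : Type := Σₗ b : Fin 9, Fin (size m k b)

theorem card_Idx (m k : ℕ) : Fintype.card (Idx m k) = 2 * (k + m + 2) + 1 := by
  have h : Fintype.card (Idx m k) = ∑ b : Fin 9, size m k b := by
    rw [Fintype.card_lex, Fintype.card_sigma]
    exact Finset.sum_congr rfl fun b _ => Fintype.card_fin _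
  rw [h]
  simp [Fin.sum_univ_succ, size]
  ring

variable {m k : ℕ}

/-- The index at place `r` of block `b`. -/
def pos (b : Fin 9) (r : Fin (size m k b)) : Idx m k := toLex ⟨b, r⟩

/-- The matrix `f`, as a combination of matrix units. Its blocks `(8, 0)` and `(5, 3)` are the
matrices with second diagonal `l₁` resp. `l₂`, read from the lower left to the upper right corner,
and zeros elsewhere; the blocks `(6, 1)`, `(7, 2)`, `(7, 6)` are `γ₁`, `γ₂`, `γ₃`. -/
def fMat (l₁ : Fin m → ℝ) (l₂ : Fin k → ℝ) (γ₁ γ₂ γ₃ : ℝ) : Matrix (Idx m k) (Idx m k) ℝ :=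
  (∑ r : Fin m, Matrix.single (pos 8 (Fin.rev r)) (pos 0 r) (l₁ r)) +
  (∑ r : Fin k, Matrix.single (pos 5 (Fin.rev r)) (pos 3 r) (l₂ r)) +
  Matrix.single (pos 6 (0 : Fin 1)) (pos 1 (0 : Fin 1)) γ₁ +
  Matrix.single (pos 7 (0 : Fin 1)) (pos 2 (0 : Fin 1)) γ₂ +
  Matrix.single (pos 7 (0 : Fin 1)) (pos 6 (0 : Fin 1)) γ₃

variable (m k)

/-- The block in place `(a, b)` of the general element of the group. -/
def C (a b : Fin 9) : Matrix (Fin (size m k a)) (Fin (size m k b)) (RegFun (Idx m k)) :=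
  fun r q => genericMat (Idx m k) (pos a r) (pos b q)

/-- Row blocks of the three pairs `(1, 2), (3, 5), (6, 7)` of the set `Φ`. -/
def rowBlk : Fin 3 → Fin 9 := ![1, 3, 6]

/-- Column blocks of the three pairs `(1, 2), (3, 5), (6, 7)` of the set `Φ`. -/
def colBlk : Fin 3 → Fin 9 := ![2, 5, 7]

theorem size_rowBlk (s : Fin 3) : size m k (rowBlk s) = size m k (colBlk s) := by
  fin_cases s <;> rfl

/-- The square block of the general element in the place given by the `s`-th pair of `Φ`. -/
def pivot (s : Fin 3) :
    Matrix (Fin (size m k (rowBlk s))) (Fin (size m k (rowBlk s))) (RegFun (Idx m k)) :=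
  (C m k (rowBlk s) (colBlk s)).submatrix id (Fin.cast (size_rowBlk m k s))

/-- The function `d₁ = det C₁₂ · det C₃₅ · det C₆₇`. -/
def d₁ : RegFun (Idx m k) := (pivot m k 0).det * (pivot m k 1).det * (pivot m k 2).det

/-- The localization `ℝ'[G]` of `ℝ[G]` by the powers of `d₁`. -/
abbrev RegFun' : Type := Localization.Away (d₁ m k)

/-- For an entry in block `(i, j)`: the pairs `(a, b) ∈ Φ` with `a > i` and `b < j`. -/
abbrev PhiOf (i j : Fin 9) : Type := {s : Fin 3 // i < rowBlk s ∧ colBlk s < j}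

/-- Row (and column) numbers of the minor attached to an entry in block `(i, j)`. -/
abbrev MinorIdx (i j : Fin 9) : Type := Σ s : PhiOf i j, Fin (size m k (rowBlk s.1))

variable {m k}

/-- The index of the row with a given number. -/
def minorRow {i j : Fin 9} (x : MinorIdx m k i j) : Idx m k := pos (rowBlk x.1.1) x.2

/-- The index of the column with a given number. -/
def minorCol {i j : Fin 9} (x : MinorIdx m k i j) : Idx m k :=
  pos (colBlk x.1.1) (Fin.cast (size_rowBlk m k x.1.1) x.2)

variable (m k)

/-- `Δ(c)` for an entry `c` in block `(i, j)`: the minor of the general element on the rows of the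
blocks `a` and the columns of the blocks `b`, for `(a, b)` in `Φ(c)`. -/
def Δ (i j : Fin 9) : RegFun (Idx m k) :=
  ((genericMat (Idx m k)).submatrix (minorRow (i := i) (j := j)) minorCol).det

/-- The minor obtained from `Δ(c)` by adding the row and the column of the entry `c` in place
`(r, q)` of block `(i, j)`. The new row and the new column are written last, so that `c` has the
sign `+` in it; in the increasing order of the rows, the row of `c` is the first one, which
multiplies both the minor and the sign of `c` in it by the same power of `-1`. -/
def ΔTilde (i j : Fin 9) (r : Fin (size m k i)) (q : Fin (size m k j)) : RegFun (Idx m k) :=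
  ((genericMat (Idx m k)).submatrix
    (Sum.elim (minorRow (i := i) (j := j)) fun _ : Unit => pos i r)
    (Sum.elim (minorCol (i := i) (j := j)) fun _ : Unit => pos j q)).det

theorem genericMat_eq_zero {p q : Idx m k} (h : q < p) : genericMat (Idx m k) p q = 0 := by
  simp [genericMat, h.ne', not_lt.2 h.le]

theorem Δ_eq_prod (i j : Fin 9) : Δ m k i j = ∏ s : PhiOf i j, (pivot m k s.1).det := by
  have hlt : ∀ s t : Fin 3, t < s → colBlk t < rowBlk s := by decide
  have hb : Matrix.BlockTriangular
      ((genericMat (Idx m k)).submatrix (minorRow (i := i) (j := j)) minorCol) Sigma.fst := by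
    intro x y hxy
    exact genericMat_eq_zero m k (Sigma.Lex.lt_def.2 (Or.inl (hlt _ _ hxy)))
  rw [Δ, hb.det_fintype]
  refine Finset.prod_congr rfl fun s _ => ?_
  let e : Fin (size m k (rowBlk s.1)) ≃ {x : MinorIdx m k i j // x.1 = s} :=
    { toFun := fun r => ⟨⟨s, r⟩, rfl⟩
      invFun := fun x => Fin.cast (by rw [x.2]) x.1.2
      left_inv := fun r => rfl
      right_inv := by rintro ⟨⟨t, r⟩, rfl⟩; rfl }
  rw [← Matrix.det_submatrix_equiv_self e]
  rfl

/-- The minors `Δ(c)` are invertible in the localization, so that `Δ(c)⁻¹` makes sense there. -/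
theorem isUnit_Δ (i j : Fin 9) : IsUnit (algebraMap _ (RegFun' m k) (Δ m k i j)) := by
  have h : IsUnit (algebraMap _ (RegFun' m k)
      ((pivot m k 0).det * (pivot m k 1).det * (pivot m k 2).det)) :=
    IsLocalization.Away.algebraMap_isUnit (d₁ m k)
  have hs : ∀ s, IsUnit (algebraMap _ (RegFun' m k) (pivot m k s).det) := by
    rw [map_mul, map_mul, IsUnit.mul_iff, IsUnit.mul_iff] at h
    intro s
    fin_cases s
    exacts [h.1.1, h.1.2, h.2]
  rw [Δ_eq_prod, map_prod, IsUnit.prod_univ_iff]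
  exact fun s => hs s.1

/-- The function `c̃ = ± Δ(c)⁻¹ Δ̃(c)` in `ℝ'[G]`, for the entry `c` in place `(r, q)` of block
`(i, j)`. -/
def cTilde (i j : Fin 9) (r : Fin (size m k i)) (q : Fin (size m k j)) : RegFun' m k :=
  ((isUnit_Δ m k i j).unit⁻¹ : (RegFun' m k)ˣ) * algebraMap _ (RegFun' m k) (ΔTilde m k i j r q)

/-- The blocks marked by a bullet. -/
def bullets : Set (Fin 9 × Fin 9) :=
  {(0, 1), (0, 3), (0, 4), (0, 6), (2, 3), (2, 4), (2, 6), (2, 8), (3, 4), (4, 5), (4, 6), (4, 8),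
    (5, 6), (5, 8), (7, 8)}

/-- The entries above the diagonal in the diagonal blocks of sizes `m, k, k, m`. -/
def S₀ : Set (RegFun (Idx m k)) :=
  {φ | ∃ b ∈ ({0, 3, 5, 8} : Set (Fin 9)), ∃ r q : Fin (size m k b), r < q ∧ φ = C m k b b r q}

/-- The functions `c̃` for the entries `c` of the marked blocks. -/
def S₁ : Set (RegFun' m k) :=
  {φ | ∃ i j : Fin 9, (i, j) ∈ bullets ∧ ∃ r q, φ = cTilde m k i j r q}

/-- The entries of `C₁₂ C₂₅ + C₁₃ C₃₅` and `C₃₅ C₅₇ + C₃₆ C₆₇`, and `γ₁ C₁₂ - γ₂ C₆₇`. -/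
def S₂ (γ₁ γ₂ : ℝ) : Set (RegFun (Idx m k)) :=
  {φ | ∃ r q, φ = (C m k 1 2 * C m k 2 5 + C m k 1 3 * C m k 3 5) r q} ∪
  {φ | ∃ r q, φ = (C m k 3 5 * C m k 5 7 + C m k 3 6 * C m k 6 7) r q} ∪
  {MvPolynomial.C γ₁ * C m k 1 2 (0 : Fin 1) (0 : Fin 1) -
    MvPolynomial.C γ₂ * C m k 6 7 (0 : Fin 1) (0 : Fin 1)}

/-- The system `S = S₀ ∪ S₁ ∪ S₂` in `ℝ'[G]`. -/
def S (γ₁ γ₂ : ℝ) : Set (RegFun' m k) :=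
  algebraMap (RegFun (Idx m k)) (RegFun' m k) '' S₀ m k ∪ S₁ m k ∪
    algebraMap (RegFun (Idx m k)) (RegFun' m k) '' S₂ m k γ₁ γ₂

/-- The ideal `I'` of `ℝ'[G]` generated by `S`. -/
def I' (γ₁ γ₂ : ℝ) : Ideal (RegFun' m k) := Ideal.span (S m k γ₁ γ₂)

end Odd

end Subregular

end

/-!
Everything is expressed through `Y = g - 1` and its blocks, numbered from `0` to `8` as in `fMat`.

An element `g` stabilizes `f` exactly when `Y` commutes with `f` modulo upper triangular matrices,
and this determines the blocks of `Y`: only the places `(0, 8)`, `(1, 2)`, `(1, 6)`, `(1, 7)`,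
`(2, 7)`, `(3, 5)` and `(6, 7)` can be nonzero, the blocks `(0, 8)` and `(3, 5)` live on the second
diagonal, and the blocks `(1, 2)` and `(6, 7)` are linked by one linear relation. For such a `Y`
with `d₁ ≠ 0`, every conjugate of `g` is a zero of `I'`: the bordered minors vanish because the
ranks of the lower left corners of `Y` do not change under multiplication by unitriangular
matrices, and the quadratic elements of `S` are blocks of `Y ^ 2` up to products that vanish; for
`g` in the stabilizer the only nonzero block of `Y ^ 2` has place `(1, 7)`. The condition `d₁ ≠ 0`
holds on a dense subset of the stabilizer.

Conversely, for a zero of `I'` the vanishing of the bordered minors makes the columns of `Y`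
combinations of the pivot columns, those of the blocks `2`, `5` and `7`. Together with the quadratic
relations this gives a basis, unitriangular with respect to the standard one, in which `Y` has the
above shape except that the blocks in the places `(3, 5)` and `(0, 8)` are arbitrary. Conjugation by
block diagonal matrices brings these two blocks to the second diagonal as soon as they lie in the
big Bruhat cell, and this cell is dense.
-/

noncomputable section

namespace Subregular

/-! ### Minors and ranks -/

section Matrices

theorem det_submatrix_sumElim_of_column_relation {l n κ R : Type*} [CommRing R] [Fintype κ]
    [DecidableEq κ] {M : Matrix l n R} {f : κ → l} {g : κ → n} {q : n} {x : κ → R}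
    (h : ∀ s, ∑ t, M (f s) (g t) * x t = M (f s) q) (p : l) :
    (M.submatrix (Sum.elim f fun _ : Unit => p) (Sum.elim g fun _ : Unit => q)).det =
      (M.submatrix f g).det * (M p q - ∑ t, M p (g t) * x t) := by
  have factor : M.submatrix (Sum.elim f fun _ : Unit => p) (Sum.elim g fun _ : Unit => q) =
      Matrix.fromBlocks (M.submatrix f g) 0 (M.submatrix (fun _ => p) g)
        (Matrix.of fun _ _ => M p q - ∑ t, M p (g t) * x t) *
      Matrix.fromBlocks 1 (Matrix.of fun t _ => x t) 0 1 := by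
    rw [Matrix.fromBlocks_multiply]
    ext (s | s) (t | t)
    · simp
    · simp [Matrix.mul_apply, h]
    · simp
    · simp [Matrix.mul_apply]
  rw [factor, Matrix.det_mul, Matrix.det_fromBlocks_zero₁₂, Matrix.det_fromBlocks_zero₂₁]
  simp

theorem det_submatrix_eq_zero_of_rank_lt {l n κ K : Type*} [Field K] [Fintype n] [Fintype κ]
    [DecidableEq κ] {A : Matrix l n K} (h : A.rank < Fintype.card κ) (f : κ → l) (g : κ → n) :
    (A.submatrix f g).det = 0 := by
  by_contra hdet
  have hrank := Matrix.rank_of_isUnit _ ((Matrix.isUnit_iff_isUnit_det _).2 (Ne.isUnit hdet))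
  exact absurd (A.rank_submatrix_le f g) (by omega)

theorem rank_le_card_of_row_eq_zero {l n κ R : Type*} [CommSemiring R] [StrongRankCondition R]
    [Fintype n] [Fintype κ] (f : κ → l) {A : Matrix l n R}
    (h : ∀ p ∉ Set.range f, ∀ q, A p q = 0) : A.rank ≤ Fintype.card κ := by
  classical
  refine (A.rank_le_card_of_support_subset (Finset.univ.image f) fun p hp => ?_).trans
    Finset.card_image_le
  by_contra hmem
  exact hp (funext (h p (by simpa using hmem)))

theorem rank_le_card_of_col_eq_zero {l n κ K : Type*} [Field K] [Finite l] [Fintype n]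
    [Fintype κ] (g : κ → n) {A : Matrix l n K} (h : ∀ q ∉ Set.range g, ∀ p, A p q = 0) :
    A.rank ≤ Fintype.card κ := by
  have := Fintype.ofFinite l
  rw [← A.rank_transpose]
  exact rank_le_card_of_row_eq_zero g h

theorem mul_mul_apply_congr_of_isUpperTriangular {ι R : Type*} [Fintype ι] [LinearOrder ι]
    [NonUnitalNonAssocSemiring R] {H K X X' : Matrix ι ι R} (hH : H.IsUpperTriangular)
    (hK : K.IsUpperTriangular) {p q : ι} (h : ∀ a b, p ≤ a → b ≤ q → X a b = X' a b) :
    (H * X * K) p q = (H * X' * K) p q := by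
  simp only [Matrix.mul_apply]
  refine Finset.sum_congr rfl fun b _ => ?_
  rcases le_or_gt b q with hb | hb
  · congr 1
    refine Finset.sum_congr rfl fun a _ => ?_
    rcases le_or_gt p a with ha | ha
    · rw [h a b ha hb]
    · rw [hH ha, zero_mul, zero_mul]
  · rw [hK hb, mul_zero, mul_zero]

theorem det_submatrix_mul_mul_eq_zero {ι κ K : Type*} [Field K] [Fintype ι] [LinearOrder ι]
    [Fintype κ] [DecidableEq κ] {H L X Z : Matrix ι ι K} (hH : H.IsUpperTriangular)
    (hL : L.IsUpperTriangular) {f g : κ → ι}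
    (hZ : ∀ s t a b, f s ≤ a → b ≤ g t → X a b = Z a b) (hrank : Z.rank < Fintype.card κ) :
    ((H * X * L).submatrix f g).det = 0 := by
  have : (H * X * L).submatrix f g = (H * Z * L).submatrix f g := by
    ext s t
    exact mul_mul_apply_congr_of_isUpperTriangular hH hL (hZ s t)
  rw [this]
  refine det_submatrix_eq_zero_of_rank_lt (lt_of_le_of_lt ?_ hrank) f g
  exact ((H * Z).rank_mul_le_left L).trans (H.rank_mul_le_right Z)

theorem eventually_det_add_smul_ne_zero {n K : Type*} [Fintype n] [DecidableEq n] [Field K]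
    [TopologicalSpace K] [T1Space K] (A : Matrix n n K) {B : Matrix n n K} (hB : B.det ≠ 0) :
    ∀ᶠ ε : K in nhdsWithin 0 {0}ᶜ, (A + ε • B).det ≠ 0 := by
  set P : Polynomial K :=
    ((Polynomial.X : Polynomial K) • B.map Polynomial.C + A.map Polynomial.C).det with hP
  have hP0 : P ≠ 0 := fun h => hB (by
    rw [← Polynomial.coeff_det_X_add_C_card B A, ← hP, h, Polynomial.coeff_zero])
  have heval : ∀ ε, P.eval ε = (A + ε • B).det := fun ε => by
    rw [hP, ← Polynomial.coe_evalRingHom, RingHom.map_det]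
    congr 1
    ext i j
    simp [add_comm, mul_comm (B i j)]
  refine nhdsNE_le_cofinite 0 ((P.rootSet_finite K).subset fun ε hε => ?_)
  rw [Polynomial.mem_rootSet_of_ne hP0, Polynomial.coe_aeval_eq_eval, heval]
  simpa using hε

end Matrices

/-! ### The unitriangular group and its regular functions -/

section UnitriangularGroup

variable {ι : Type} [Fintype ι] [LinearOrder ι]

theorem mat_mul (g h : UT ι) : mat (g * h) = mat g * mat h := rfl

theorem mat_one : mat (1 : UT ι) = 1 := rfl

theorem mat_mul_mat_inv (g : UT ι) : mat g * mat g⁻¹ = 1 := by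
  rw [← mat_mul, mul_inv_cancel, mat_one]

theorem mat_inv_mul_mat (g : UT ι) : mat g⁻¹ * mat g = 1 := by
  rw [← mat_mul, inv_mul_cancel, mat_one]

theorem mat_apply_self (g : UT ι) (i : ι) : mat g i i = 1 := g.2.1 i

theorem isUpperTriangular_mat (g : UT ι) : (mat g).IsUpperTriangular := g.2.2

theorem mat_injective : Function.Injective (mat : UT ι → Matrix ι ι ℝ) := fun _ _ h =>
  Subtype.ext (Subtype.ext h)

theorem isInducing_mat : Topology.IsInducing (mat : UT ι → Matrix ι ι ℝ) :=
  Topology.IsInducing.subtypeVal.comp Topology.IsInducing.subtypeVal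

/-- The element of the unitriangular group with a given matrix. -/
def ofMat (M : Matrix ι ι ℝ) (hdiag : ∀ i, M i i = 1) (hM : M.IsUpperTriangular) : UT ι :=
  ⟨⟨M, by rw [Matrix.det_of_isUpperTriangular hM]; exact Finset.prod_eq_one fun i _ => hdiag i⟩,
    hdiag, fun _ _ h => hM h⟩

theorem mat_sub_one_mem_ut (g : UT ι) : mat g - 1 ∈ ut ι := by
  intro i j hji
  rcases hji.lt_or_eq with h | rfl
  · simp [isUpperTriangular_mat g h, h.ne']
  · simp [mat_apply_self]

/-- The homeomorphism `x ↦ 1 + x` from the Lie algebra onto the unitriangular group. -/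
def oneAdd (x : ut ι) : UT ι :=
  ofMat (1 + x.1) (fun i => by simp [x.2 i i le_rfl])
    (fun i j (h : j < i) => by simp [x.2 i j h.le, h.ne'])

theorem mat_oneAdd_sub_one (x : ut ι) : mat (oneAdd x) - 1 = x :=
  add_sub_cancel_left _ _

theorem continuous_oneAdd : Continuous (oneAdd : ut ι → UT ι) :=
  isInducing_mat.continuous_iff.2 (continuous_const.add continuous_subtype_val)

theorem mat_sub_one_injective : Function.Injective fun g : UT ι => mat g - 1 :=
  sub_left_injective.comp mat_injective

theorem mat_conj_sub_one (h x : UT ι) :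
    mat (h * x * h⁻¹) - 1 = mat h * (mat x - 1) * mat h⁻¹ := by
  rw [mul_sub, sub_mul, mat_mul, mat_mul, mul_one, mat_mul_mat_inv]

theorem eq_conj_of_mat_sub_one_mul {g h x : UT ι}
    (H : (mat g - 1) * mat h = mat h * (mat x - 1)) : g = h * x * h⁻¹ := by
  rw [eq_mul_inv_iff_mul_eq]
  refine mat_injective ?_
  rwa [sub_mul, mul_sub, one_mul, mul_one, sub_left_inj] at H

theorem mat_conj_mul_conj (h : UT ι) (X Y : Matrix ι ι ℝ) :
    mat h * X * mat h⁻¹ * (mat h * Y * mat h⁻¹) = mat h * (X * Y) * mat h⁻¹ := by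
  calc _ = mat h * X * (mat h⁻¹ * mat h) * Y * mat h⁻¹ := by simp only [mul_assoc]
    _ = _ := by rw [mat_inv_mul_mat, mul_one]; simp only [mul_assoc]

theorem isUpperTriangular_iff_trace_mul_eq_zero (M : Matrix ι ι ℝ) :
    M.IsUpperTriangular ↔ ∀ x ∈ ut ι, Matrix.trace (M * x) = 0 := by
  constructor
  · intro hM x hx
    refine Finset.sum_eq_zero fun i _ => ?_
    rw [Matrix.diag_apply, Matrix.mul_apply]
    refine Finset.sum_eq_zero fun j _ => ?_
    rcases lt_or_ge j i with hj | hj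
    · rw [hM hj, zero_mul]
    · rw [hx j i hj, mul_zero]
  · intro h i j (hji : j < i)
    have hx : Matrix.single j i (1 : ℝ) ∈ ut ι := by
      intro a b hba
      refine Matrix.single_apply_of_ne _ _ _ _ _ ?_
      rintro ⟨rfl, rfl⟩
      exact absurd hji (not_lt.2 hba)
    simpa [Matrix.trace_mul_single] using h _ hx

/-- The stabilizer `𝔤^f` of the linear form `x ↦ tr (f x)` in the Lie algebra: the strictly upper
triangular `x` for which the form vanishes on all brackets with `x`. The latter is encoded by the
matrix `x f - f x` being upper triangular. -/
def coadStabAlgebra (f : Matrix ι ι ℝ) : Submodule ℝ (Matrix ι ι ℝ) where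
  carrier := {x | x ∈ ut ι ∧ (x * f - f * x).IsUpperTriangular}
  zero_mem' := ⟨zero_mem _, fun _ _ _ => by simp⟩
  add_mem' := fun ⟨hx, hx'⟩ ⟨hy, hy'⟩ => ⟨add_mem hx hy, by
    rw [add_mul, mul_add, add_sub_add_comm]; exact hx'.add hy'⟩
  smul_mem' := fun c x ⟨hx, hx'⟩ => ⟨Submodule.smul_mem _ c hx, fun i j h => by
    rw [smul_mul_assoc, mul_smul_comm, ← smul_sub, Matrix.smul_apply, hx' h, smul_zero]⟩

theorem mem_coadStabilizer_iff (f : Matrix ι ι ℝ) (g : UT ι) :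
    g ∈ coadStabilizer f ↔ mat g - 1 ∈ coadStabAlgebra f := by
  set F := mat g * f * mat g⁻¹ - f with hF
  have htrace : ∀ x, Matrix.trace (f * (mat g⁻¹ * x * mat g)) - Matrix.trace (f * x) =
      Matrix.trace (F * x) := by
    intro x
    rw [hF, sub_mul, Matrix.trace_sub, ← mul_assoc, Matrix.trace_mul_comm]
    simp only [mul_assoc]
  have hmul : F * mat g = (mat g - 1) * f - f * (mat g - 1) := by
    rw [hF, sub_mul, mul_assoc _ (mat g⁻¹), mat_inv_mul_mat]
    noncomm_ring
  have hdiv : ((mat g - 1) * f - f * (mat g - 1)) * mat g⁻¹ = F := by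
    rw [← hmul, mul_assoc, mat_mul_mat_inv, mul_one]
  calc g ∈ coadStabilizer f ↔ ∀ x ∈ ut ι, Matrix.trace (F * x) = 0 := by
        simp only [← htrace, sub_eq_zero]; rfl
    _ ↔ F.IsUpperTriangular := (isUpperTriangular_iff_trace_mul_eq_zero F).symm
    _ ↔ ((mat g - 1) * f - f * (mat g - 1)).IsUpperTriangular :=
        ⟨fun h => hmul ▸ h.mul (isUpperTriangular_mat g),
          fun h => hdiv ▸ h.mul (isUpperTriangular_mat g⁻¹)⟩
    _ ↔ mat g - 1 ∈ coadStabAlgebra f := (and_iff_right (mat_sub_one_mem_ut g)).symm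

end UnitriangularGroup

section RegularFunctions

variable {ι : Type} [Fintype ι] [LinearOrder ι]

theorem evalAt_genericMat (g : UT ι) (i j : ι) : evalAt g (genericMat ι i j) = mat g i j := by
  unfold genericMat
  split_ifs with h h'
  · simp [evalAt]
  · rw [map_one, h', mat_apply_self]
  · rw [map_zero, isUpperTriangular_mat g (lt_of_le_of_ne (not_lt.1 h) (Ne.symm h'))]

theorem evalAt_C (g : UT ι) (c : ℝ) : evalAt g (MvPolynomial.C c) = c := by
  simp [evalAt]

theorem evalAt_det_submatrix_genericMat {κ : Type*} [Fintype κ] [DecidableEq κ] (g : UT ι)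
    (a b : κ → ι) :
    evalAt g ((genericMat ι).submatrix a b).det = ((mat g).submatrix a b).det := by
  rw [RingHom.map_det]
  congr 1
  ext r q
  exact evalAt_genericMat g _ _

theorem mem_zeroSet_span_iff {d : RegFun ι} {S : Set (Localization.Away d)} {g : UT ι} :
    g ∈ zeroSet d (Ideal.span S) ↔ ∃ hd : evalAt g d ≠ 0, ∀ φ ∈ S,
      IsLocalization.Away.lift (S := Localization.Away d) d (g := evalAt g) hd.isUnit φ = 0 :=
  exists_congr fun _ => Ideal.span_le (I := RingHom.ker _)

end RegularFunctions

/-! ### The big cell -/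

section BigCell

open Matrix

variable {n : ℕ}

/-- The block matrix `[[d, b], [c, B]]` with a `1 × 1` block in the upper left corner. -/
def bordered {R : Type*} (d : R) (b c : Fin n → R) (B : Matrix (Fin n) (Fin n) R) :
    Matrix (Fin (n + 1)) (Fin (n + 1)) R :=
  Matrix.of (Fin.cons (Fin.cons d b) fun i => Fin.cons (c i) (B i))

theorem bordered_eta {R : Type*} (A : Matrix (Fin (n + 1)) (Fin (n + 1)) R) :
    bordered (A 0 0) (fun j => A 0 j.succ) (fun i => A i.succ 0)
      (A.submatrix Fin.succ Fin.succ) = A := by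
  ext i j
  refine Fin.cases ?_ (fun i => ?_) i <;> refine Fin.cases ?_ (fun j => ?_) j <;> simp [bordered]

theorem bordered_transpose {R : Type*} (d : R) (b c : Fin n → R) (B : Matrix (Fin n) (Fin n) R) :
    (bordered d b c B)ᵀ = bordered d c b Bᵀ := by
  ext i j
  refine Fin.cases ?_ (fun i => ?_) i <;> refine Fin.cases ?_ (fun j => ?_) j <;> simp [bordered]

theorem bordered_mul_bordered {R : Type*} [Semiring R] (d d' : R) (b b' c c' : Fin n → R)
    (B B' : Matrix (Fin n) (Fin n) R) : bordered d b c B * bordered d' b' c' B' =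
      bordered (d * d' + b ⬝ᵥ c') (fun j => d * b' j + (b ᵥ* B') j)
        (fun i => c i * d' + (B *ᵥ c') i) (vecMulVec c b' + B * B') := by
  ext i j
  rw [Matrix.mul_apply, Fin.sum_univ_succ]
  refine Fin.cases ?_ (fun i => ?_) i <;> refine Fin.cases ?_ (fun j => ?_) j <;>
    simp [bordered, Matrix.mul_apply, dotProduct, vecMul, mulVec, vecMulVec_apply]

theorem diagonal_cons {R : Type*} [Zero R] (d : R) (e : Fin n → R) :
    diagonal (Fin.cons d e : Fin (n + 1) → R) = bordered d 0 0 (diagonal e) := by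
  ext i j
  refine Fin.cases ?_ (fun i => ?_) i <;> refine Fin.cases ?_ (fun j => ?_) j <;>
    simp [bordered, diagonal_apply, (Fin.succ_ne_zero _).symm]

theorem continuous_bordered {X R : Type*} [TopologicalSpace X] [TopologicalSpace R] (d : R)
    (b c : Fin n → R) {B : X → Matrix (Fin n) (Fin n) R} (hB : Continuous B) :
    Continuous fun x => bordered d b c (B x) := by
  refine continuous_matrix fun i j => ?_
  refine Fin.cases ?_ (fun i => ?_) i <;> refine Fin.cases ?_ (fun j => ?_) j
  all_goals simp only [bordered, Matrix.of_apply, Fin.cons_succ, Fin.cons_zero]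
  any_goals exact continuous_const
  exact hB.matrix_elem i j

/-- The unitriangular matrix `[[1, b], [0, u]]`. -/
def UT.bordered (b : Fin n → ℝ) (u : UT (Fin n)) : UT (Fin (n + 1)) :=
  ofMat (Subregular.bordered 1 b 0 (mat u))
    (fun i => by refine Fin.cases ?_ (fun i => ?_) i <;> simp [Subregular.bordered, mat_apply_self])
    (fun i j (hij : j < i) => by
      revert hij
      refine Fin.cases ?_ (fun i => ?_) i <;> refine Fin.cases ?_ (fun j => ?_) j <;> intro hij
      · exact absurd hij (lt_irrefl _)
      · exact absurd hij (Fin.not_lt_zero _)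
      · rfl
      · exact isUpperTriangular_mat u (Fin.succ_lt_succ_iff.1 hij))

theorem mat_bordered (b : Fin n → ℝ) (u : UT (Fin n)) :
    mat (UT.bordered b u) = Subregular.bordered 1 b 0 (mat u) := rfl

/-- The matrices `A` with `A V = L D`, where `L` is lower and `V` is upper unitriangular and `D` is
diagonal. -/
def lowerCell (n : ℕ) : Set (Matrix (Fin n) (Fin n) ℝ) :=
  {A | ∃ (u v : UT (Fin n)) (d : Fin n → ℝ), A * mat v = (mat u)ᵀ * diagonal d}

theorem bordered_mem_lowerCell {d : ℝ} (hd : d ≠ 0) (b c : Fin n → ℝ)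
    {B : Matrix (Fin n) (Fin n) ℝ} (hB : B ∈ lowerCell n) :
    bordered d b c (B + d⁻¹ • vecMulVec c b) ∈ lowerCell (n + 1) := by
  obtain ⟨u, v, e, h⟩ := hB
  refine ⟨UT.bordered (d⁻¹ • c) u, UT.bordered (-d⁻¹ • (b ᵥ* mat v)) v, Fin.cons d e, ?_⟩
  rw [mat_bordered, mat_bordered, bordered_transpose, diagonal_cons,
    bordered_mul_bordered, bordered_mul_bordered, add_mul, h]
  congr 1
  · simp
  · ext j
    simp [hd]
  · ext i
    simp [hd, mul_comm]
  · ext i j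
    simp [vecMulVec_mul, vecMulVec_apply]

theorem dense_lowerCell (n : ℕ) : Dense (lowerCell n) := by
  induction n with
  | zero => exact fun A => subset_closure ⟨1, 1, 0, Subsingleton.elim _ _⟩
  | succ n ih =>
    have hdense : Dense {A : Matrix (Fin (n + 1)) (Fin (n + 1)) ℝ | A 0 0 ≠ 0} :=
      (dense_compl_singleton (0 : ℝ)).preimage
        ((isOpenMap_eval 0).comp (isOpenMap_eval 0))
    refine dense_closure.1 (hdense.mono fun A hA => ?_)
    set c : Fin n → ℝ := fun i => A i.succ 0
    set b : Fin n → ℝ := fun j => A 0 j.succ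
    have hA_eq : bordered (A 0 0) b c (A.submatrix Fin.succ Fin.succ - (A 0 0)⁻¹ • vecMulVec c b
        + (A 0 0)⁻¹ • vecMulVec c b) = A := by
      rw [sub_add_cancel, bordered_eta]
    rw [← hA_eq]
    exact map_mem_closure
      (f := fun B => bordered (A 0 0) b c (B + (A 0 0)⁻¹ • vecMulVec c b))
      (continuous_bordered _ _ _ (continuous_id.add continuous_const)) (ih _)
      fun B hB => bordered_mem_lowerCell hA b c hB

/-- The support of a matrix lies on the second diagonal, from the lower left to the upper right
corner. The row and column numbers may run over different types, so that the blocks in the places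
`(a, b)` and `(b, a)` of blocks of equal size are covered without a cast. -/
def IsAntidiag {R : Type*} [Zero R] {a b : ℕ} (D : Matrix (Fin a) (Fin b) R) : Prop :=
  ∀ (r : Fin a) (q : Fin b), (r : ℕ) + q + 1 ≠ a → D r q = 0

/-- The matrices `A` with `A V = U D`, where `U`, `V` are upper unitriangular and the support of `D`
lies on the second diagonal. They contain the big Bruhat cell. -/
def bigCell (n : ℕ) : Set (Matrix (Fin n) (Fin n) ℝ) :=
  {A | ∃ (u v : UT (Fin n)) (D : Matrix (Fin n) (Fin n) ℝ), IsAntidiag D ∧ A * mat v = mat u * D}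

/-- Reversal of the order of rows and columns takes the transpose of an upper unitriangular matrix
to an upper unitriangular matrix. -/
def UT.revTranspose (u : UT (Fin n)) : UT (Fin n) :=
  ofMat ((mat u)ᵀ.submatrix Fin.rev Fin.rev) (fun _ => mat_apply_self u _)
    (fun _ _ hij => isUpperTriangular_mat u (Fin.rev_lt_rev.2 hij))

theorem dense_bigCell (n : ℕ) : Dense (bigCell n) := by
  have hsurj : Function.Surjective fun B : Matrix (Fin n) (Fin n) ℝ => B.submatrix Fin.rev id :=
    fun A => ⟨A.submatrix Fin.rev id, by simp [Fin.rev_involutive.comp_self]⟩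
  refine (hsurj.denseRange.dense_image (continuous_id.matrix_submatrix _ _)
    (dense_lowerCell n)).mono ?_
  rintro _ ⟨B, ⟨u, v, d, h⟩, rfl⟩
  refine ⟨UT.revTranspose u, v, (diagonal d).submatrix Fin.rev id, fun r q hrq => ?_, ?_⟩
  · refine diagonal_apply_ne _ fun (hrev : Fin.rev r = q) => hrq ?_
    rw [← hrev, Fin.val_rev]
    omega
  · calc B.submatrix Fin.rev id * mat v = ((mat u)ᵀ * diagonal d).submatrix Fin.rev id := by
          rw [← h]; rfl
      _ = mat (UT.revTranspose u) * (diagonal d).submatrix Fin.rev id :=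
        (submatrix_mul_equiv _ _ Fin.rev Fin.revPerm id).symm

end BigCell

/-! ### Block matrices -/

section Blocks

variable {m k : ℕ}

/-- The block containing an index. -/
def blkOf (p : Idx m k) : Fin 9 := (ofLex p).1

theorem exists_eq_pos (p : Idx m k) : ∃ r, p = pos (blkOf p) r := ⟨(ofLex p).2, rfl⟩

theorem pos_injective (b : Fin 9) : Function.Injective (pos b : Fin (size m k b) → Idx m k) :=
  toLex.injective.comp sigma_mk_injective

theorem pos_inj {b : Fin 9} {r q : Fin (size m k b)} : (pos b r : Idx m k) = pos b q ↔ r = q :=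
  (pos_injective b).eq_iff

theorem pos_ne_pos {a b : Fin 9} (h : a ≠ b) (r : Fin (size m k a)) (q : Fin (size m k b)) :
    (pos a r : Idx m k) ≠ pos b q := fun e => h (congrArg blkOf e)

theorem blkOf_mono {p q : Idx m k} (h : p ≤ q) : blkOf p ≤ blkOf q := by
  rcases Sigma.Lex.le_def.1 h with h | ⟨h, _⟩
  exacts [h.le, h.le]

theorem lt_of_blkOf_lt {p q : Idx m k} (h : blkOf p < blkOf q) : p < q :=
  Sigma.Lex.lt_def.2 (Or.inl h)

theorem pos_lt_pos {b : Fin 9} {r q : Fin (size m k b)} :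
    (pos b r : Idx m k) < pos b q ↔ r < q :=
  ⟨fun h => (Sigma.Lex.lt_def.1 h).elim (fun h => absurd h (lt_irrefl _)) fun ⟨_, h⟩ => h,
    fun h => Sigma.Lex.lt_def.2 (Or.inr ⟨rfl, h⟩)⟩

theorem sum_idx {A : Type*} [AddCommMonoid A] (F : Idx m k → A) :
    ∑ p, F p = ∑ b, ∑ r, F (pos b r) :=
  Fintype.sum_sigma fun x : Σ b : Fin 9, Fin (size m k b) => F (toLex x)

theorem sum_fin_nine {A : Type*} [AddCommMonoid A] (f : Fin 9 → A) :
    ∑ c, f c = f 0 + f 1 + f 2 + f 3 + f 4 + f 5 + f 6 + f 7 + f 8 := by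
  rw [Fin.sum_univ_castSucc, Fin.sum_univ_eight]
  rfl

/-- The block of a matrix in place `(a, b)`. -/
def blk (M : Matrix (Idx m k) (Idx m k) ℝ) (a b : Fin 9) :
    Matrix (Fin (size m k a)) (Fin (size m k b)) ℝ := M.submatrix (pos a) (pos b)

theorem blk_apply (M : Matrix (Idx m k) (Idx m k) ℝ) (a b : Fin 9) (r : Fin (size m k a))
    (q : Fin (size m k b)) : blk M a b r q = M (pos a r) (pos b q) := rfl

theorem blk_add (M N : Matrix (Idx m k) (Idx m k) ℝ) (a b : Fin 9) :
    blk (M + N) a b = blk M a b + blk N a b := rfl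

theorem blk_sub (M N : Matrix (Idx m k) (Idx m k) ℝ) (a b : Fin 9) :
    blk (M - N) a b = blk M a b - blk N a b := rfl

theorem blk_mul (M N : Matrix (Idx m k) (Idx m k) ℝ) (a b : Fin 9) :
    blk (M * N) a b = ∑ c, blk M a c * blk N c b := by
  ext r q
  rw [blk_apply, Matrix.mul_apply, sum_idx, Matrix.sum_apply]
  rfl

theorem blk_eq_zero_of_isUpperTriangular {M : Matrix (Idx m k) (Idx m k) ℝ}
    (hM : M.IsUpperTriangular) {a b : Fin 9} (hba : b < a) : blk M a b = 0 := by
  ext r q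
  exact hM (lt_of_blkOf_lt (p := pos b q) (q := pos a r) hba)

theorem blk_apply_eq_zero_of_mem_ut {x : Matrix (Idx m k) (Idx m k) ℝ} (hx : x ∈ ut (Idx m k))
    {b : Fin 9} {r q : Fin (size m k b)} (hqr : q ≤ r) : blk x b b r q = 0 :=
  hx _ _ (not_lt.1 fun h => absurd (pos_lt_pos.1 h) (not_lt.2 hqr))

theorem blk_eq_zero_of_mem_ut {x : Matrix (Idx m k) (Idx m k) ℝ} (hx : x ∈ ut (Idx m k))
    {a b : Fin 9} (hba : b < a) : blk x a b = 0 := by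
  ext r q
  exact hx _ _ (lt_of_blkOf_lt (p := pos b q) (q := pos a r) hba).le

theorem mem_ut_of_blk {x : Matrix (Idx m k) (Idx m k) ℝ}
    (h : ∀ a b, b ≤ a → blk x a b = 0) : x ∈ ut (Idx m k) := by
  intro p q hqp
  obtain ⟨r, hr⟩ := exists_eq_pos p
  obtain ⟨s, hs⟩ := exists_eq_pos q
  rw [hr, hs]
  exact congrFun (congrFun (h _ _ (blkOf_mono hqp)) r) s

theorem isUpperTriangular_iff_blk {N : Matrix (Idx m k) (Idx m k) ℝ} : N.IsUpperTriangular ↔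
    (∀ a b, b < a → blk N a b = 0) ∧ ∀ b, (blk N b b).IsUpperTriangular := by
  refine ⟨fun h => ⟨fun a b => blk_eq_zero_of_isUpperTriangular h, fun b r q hqr =>
    h (pos_lt_pos.2 hqr)⟩, fun ⟨h, hdiag⟩ p q (hqp : q < p) => ?_⟩
  obtain ⟨b, r⟩ := p
  obtain ⟨c, s⟩ := q
  rcases (blkOf_mono hqp.le).lt_or_eq with hlt | heq
  · exact congrFun (congrFun (h _ _ hlt) _) _
  · obtain rfl : c = b := heq
    exact hdiag c (pos_lt_pos.1 hqp)

/-- The identity columns of block `b`: multiplication by `inc m k b` on the right (by its transpose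
on the left) selects the columns (the rows) of block `b`. -/
def inc (m k : ℕ) (b : Fin 9) : Matrix (Idx m k) (Fin (size m k b)) ℝ :=
  (1 : Matrix (Idx m k) (Idx m k) ℝ).submatrix id (pos b)

theorem mul_inc {l : Type*} (M : Matrix l (Idx m k) ℝ) (b : Fin 9) :
    M * inc m k b = M.submatrix id (pos b) := by
  ext p r
  simp [inc, Matrix.mul_apply, Matrix.one_apply]

theorem transpose_inc_mul {n : Type*} (M : Matrix (Idx m k) n ℝ) (a : Fin 9) :
    (inc m k a)ᵀ * M = M.submatrix (pos a) id := by
  rw [← Matrix.transpose_transpose M, ← Matrix.transpose_mul, mul_inc]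
  rfl

theorem transpose_inc_mul_mul_inc (M : Matrix (Idx m k) (Idx m k) ℝ) (a b : Fin 9) :
    (inc m k a)ᵀ * M * inc m k b = blk M a b := by
  rw [transpose_inc_mul, mul_inc]
  rfl

theorem transpose_inc_mul_inc_self (b : Fin 9) :
    (inc m k b)ᵀ * inc m k b = 1 := by
  rw [transpose_inc_mul]
  exact Matrix.submatrix_one _ (pos_injective b)

theorem transpose_inc_mul_inc_of_ne {a b : Fin 9} (h : a ≠ b) :
    (inc m k a)ᵀ * inc m k b = 0 := by
  rw [transpose_inc_mul]
  ext r q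
  exact Matrix.one_apply_ne (pos_ne_pos h r q)

theorem inc_mul_apply_self {n : Type*} {b : Fin 9} (R : Matrix (Fin (size m k b)) n ℝ)
    (r : Fin (size m k b)) (q : n) : (inc m k b * R) (pos b r) q = R r q := by
  change ((inc m k b * R).submatrix (pos b) id) r q = R r q
  rw [← transpose_inc_mul, ← Matrix.mul_assoc, transpose_inc_mul_inc_self, Matrix.one_mul]

theorem inc_mul_apply_of_ne {n : Type*} {a b : Fin 9} (h : a ≠ b)
    (R : Matrix (Fin (size m k b)) n ℝ) (r : Fin (size m k a)) (q : n) :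
    (inc m k b * R) (pos a r) q = 0 := by
  change ((inc m k b * R).submatrix (pos a) id) r q = 0
  rw [← transpose_inc_mul, ← Matrix.mul_assoc, transpose_inc_mul_inc_of_ne h, Matrix.zero_mul]
  rfl

theorem sum_inc_mul_transpose_inc :
    ∑ b, inc m k b * (inc m k b)ᵀ = (1 : Matrix (Idx m k) (Idx m k) ℝ) := by
  ext p q
  obtain ⟨r, hr⟩ := exists_eq_pos p
  rw [hr, Matrix.sum_apply, Finset.sum_eq_single (blkOf p)]
  · rw [inc_mul_apply_self]
    simp [inc, Matrix.one_apply, eq_comm]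
  · exact fun b _ hb => inc_mul_apply_of_ne hb.symm _ _ _
  · simp

theorem mul_inc_eq_sum (M : Matrix (Idx m k) (Idx m k) ℝ) (b : Fin 9) :
    M * inc m k b = ∑ a, inc m k a * blk M a b := by
  calc M * inc m k b = (∑ a, inc m k a * (inc m k a)ᵀ) * (M * inc m k b) := by
        rw [sum_inc_mul_transpose_inc, Matrix.one_mul]
    _ = _ := by
        simp only [Matrix.sum_mul, ← transpose_inc_mul_mul_inc, Matrix.mul_assoc]

theorem ext_of_mul_inc {l : Type*} {M N : Matrix l (Idx m k) ℝ}
    (h : ∀ b, M * inc m k b = N * inc m k b) : M = N := by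
  ext p q
  obtain ⟨r, hr⟩ := exists_eq_pos q
  have := congrFun (congrFun (h (blkOf q)) p) r
  rwa [mul_inc, mul_inc, Matrix.submatrix_apply, Matrix.submatrix_apply, ← hr] at this

/-- The matrix with the block `N` in place `(a, b)` and zeros elsewhere. -/
def inBlock (a b : Fin 9) (N : Matrix (Fin (size m k a)) (Fin (size m k b)) ℝ) :
    Matrix (Idx m k) (Idx m k) ℝ := inc m k a * N * (inc m k b)ᵀ

theorem inBlock_single (a b : Fin 9) (r : Fin (size m k a)) (q : Fin (size m k b)) (c : ℝ) :
    inBlock a b (Matrix.single r q c) = Matrix.single (pos a r) (pos b q) c := by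
  ext x y
  rw [inBlock, Matrix.mul_apply, Finset.sum_eq_single q, Matrix.mul_single_apply_same]
  · simp only [inc, Matrix.submatrix_apply, Matrix.transpose_apply, Matrix.one_apply,
      Matrix.single_apply, id, ite_and, eq_comm]
    split_ifs <;> simp
  · intro t _ ht
    rw [Matrix.mul_single_apply_of_ne _ _ _ _ _ ht, zero_mul]
  · simp

theorem inBlock_sum {κ : Type*} (s : Finset κ) (a b : Fin 9)
    (N : κ → Matrix (Fin (size m k a)) (Fin (size m k b)) ℝ) :
    inBlock a b (∑ t ∈ s, N t) = ∑ t ∈ s, inBlock a b (N t) := by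
  simp only [inBlock, Matrix.mul_sum, Matrix.sum_mul]

section InBlock

variable (M : Matrix (Idx m k) (Idx m k) ℝ) {a b c d : Fin 9}
  (N : Matrix (Fin (size m k a)) (Fin (size m k b)) ℝ)

theorem inBlock_mul_inc_self : inBlock a b N * inc m k b = inc m k a * N := by
  rw [inBlock, Matrix.mul_assoc, transpose_inc_mul_inc_self, Matrix.mul_one]

theorem inBlock_mul_inc_of_ne (h : b ≠ d) : inBlock a b N * inc m k d = 0 := by
  rw [inBlock, Matrix.mul_assoc, transpose_inc_mul_inc_of_ne h, Matrix.mul_zero]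

theorem blk_inBlock_self : blk (inBlock a b N) a b = N := by
  rw [← transpose_inc_mul_mul_inc, Matrix.mul_assoc, inBlock_mul_inc_self, ← Matrix.mul_assoc,
    transpose_inc_mul_inc_self, Matrix.one_mul]

theorem blk_inBlock_of_ne (h : (a, b) ≠ (c, d)) : blk (inBlock a b N) c d = 0 := by
  rw [← transpose_inc_mul_mul_inc]
  by_cases hd : b = d
  · subst hd
    rw [Matrix.mul_assoc, inBlock_mul_inc_self, ← Matrix.mul_assoc,
      transpose_inc_mul_inc_of_ne fun hc => h (by rw [hc]), Matrix.zero_mul]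
  · rw [Matrix.mul_assoc, inBlock_mul_inc_of_ne N hd, Matrix.mul_zero]

theorem blk_mul_inBlock_self : blk (M * inBlock a b N) c b = blk M c a * N := by
  rw [← transpose_inc_mul_mul_inc, Matrix.mul_assoc, Matrix.mul_assoc, inBlock_mul_inc_self,
    ← Matrix.mul_assoc, ← Matrix.mul_assoc, transpose_inc_mul_mul_inc]

theorem blk_mul_inBlock_of_ne (h : b ≠ d) : blk (M * inBlock a b N) c d = 0 := by
  rw [← transpose_inc_mul_mul_inc, Matrix.mul_assoc, Matrix.mul_assoc, inBlock_mul_inc_of_ne N h,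
    Matrix.mul_zero, Matrix.mul_zero]

theorem blk_inBlock_mul_self : blk (inBlock a b N * M) a d = N * blk M b d := by
  rw [← transpose_inc_mul_mul_inc, inBlock, ← Matrix.mul_assoc, ← Matrix.mul_assoc,
    ← Matrix.mul_assoc, transpose_inc_mul_inc_self, Matrix.one_mul, Matrix.mul_assoc,
    Matrix.mul_assoc, ← Matrix.mul_assoc _ M, transpose_inc_mul_mul_inc]

theorem blk_inBlock_mul_of_ne (h : a ≠ c) : blk (inBlock a b N * M) c d = 0 := by
  rw [← transpose_inc_mul_mul_inc, inBlock, ← Matrix.mul_assoc, ← Matrix.mul_assoc,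
    ← Matrix.mul_assoc, transpose_inc_mul_inc_of_ne h.symm, Matrix.zero_mul, Matrix.zero_mul,
    Matrix.zero_mul, Matrix.zero_mul]

end InBlock

end Blocks

/-! ### Matrices supported on the second diagonal -/

section Antidiagonal

variable {n : ℕ}

/-- The matrix with second diagonal `l`, read from the lower left to the upper right corner. -/
def antidiag (l : Fin n → ℝ) : Matrix (Fin n) (Fin n) ℝ :=
  ∑ r, Matrix.single (Fin.rev r) r (l r)

theorem mul_antidiag_apply {p : Type*} (M : Matrix p (Fin n) ℝ) (l : Fin n → ℝ) (i : p)
    (r : Fin n) : (M * antidiag l) i r = M i (Fin.rev r) * l r := by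
  rw [antidiag, Matrix.mul_sum, Matrix.sum_apply, Finset.sum_eq_single r,
    Matrix.mul_single_apply_same]
  · exact fun t _ ht => Matrix.mul_single_apply_of_ne _ _ _ _ _ ht.symm _
  · simp

theorem antidiag_mul_apply {p : Type*} (M : Matrix (Fin n) p ℝ) (l : Fin n → ℝ) (r : Fin n)
    (j : p) : (antidiag l * M) (Fin.rev r) j = l r * M r j := by
  rw [antidiag, Matrix.sum_mul, Matrix.sum_apply, Finset.sum_eq_single r,
    Matrix.single_mul_apply_same]
  · exact fun t _ ht => Matrix.single_mul_apply_of_ne _ _ _ _ _ (Fin.rev_injective.ne ht.symm) _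
  · simp

theorem antidiag_apply (l : Fin n → ℝ) (i r : Fin n) :
    antidiag l i r = if i = Fin.rev r then l r else 0 := by
  rw [← Matrix.one_mul (antidiag l), mul_antidiag_apply, Matrix.one_apply, ite_mul, one_mul,
    zero_mul]

theorem isAntidiag_antidiag (l : Fin n → ℝ) : IsAntidiag (antidiag l) := by
  intro r q hrq
  rw [antidiag_apply, if_neg]
  rintro rfl
  rw [Fin.val_rev] at hrq
  omega

theorem det_antidiag_ne_zero {l : Fin n → ℝ} (hl : ∀ r, l r ≠ 0) : (antidiag l).det ≠ 0 := by
  have hperm : antidiag l =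
      (Matrix.diagonal fun r => l (Fin.rev r)).submatrix id Fin.revPerm := by
    ext i r
    rw [antidiag_apply, Matrix.submatrix_apply, Matrix.diagonal_apply, Fin.revPerm_apply, id]
    exact if_congr Iff.rfl rfl rfl |>.trans (by split_ifs with h <;> simp [h])
  rw [hperm, Matrix.det_permute', Matrix.det_diagonal]
  exact mul_ne_zero (by simp) (Finset.prod_ne_zero_iff.2 fun r _ => hl _)

theorem mul_antidiag_eq_antidiag_mul_iff (A B : Matrix (Fin 1) (Fin 1) ℝ) (c d : ℝ) :
    A * antidiag (fun _ => d) = antidiag (fun _ => c) * B ↔ c * B 0 0 = d * A 0 0 := by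
  rw [← Matrix.ext_iff, Fin.forall_fin_one, Fin.forall_fin_one, eq_comm]
  exact Eq.congr (antidiag_mul_apply B (fun _ => c) 0 0)
    ((mul_antidiag_apply A (fun _ => d) 0 0).trans (mul_comm _ _))

/-- Square matrices with nonzero entries on the second diagonal and zeros elsewhere. The two index
types are only required to have equal size, so that the notion applies to blocks. -/
def IsFullAntidiag {a b : ℕ} (L : Matrix (Fin a) (Fin b) ℝ) : Prop :=
  ∃ (h : a = b) (l : Fin b → ℝ), (∀ r, l r ≠ 0) ∧ L = (antidiag l).submatrix (Fin.cast h) id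

theorem isFullAntidiag_antidiag {l : Fin n → ℝ} (hl : ∀ r, l r ≠ 0) :
    IsFullAntidiag (antidiag l) := ⟨rfl, l, hl, rfl⟩

namespace IsFullAntidiag

variable {a b : ℕ} {L : Matrix (Fin a) (Fin b) ℝ}

theorem eq_zero_of_mul (hL : IsFullAntidiag L) {p : Type*} {M : Matrix p (Fin a) ℝ}
    (h : M * L = 0) : M = 0 := by
  obtain ⟨rfl, l, hl, rfl⟩ := hL
  ext i r
  have hir : (M * antidiag l) i (Fin.rev r) = 0 := congrFun (congrFun h i) (Fin.rev r)
  rw [mul_antidiag_apply, Fin.rev_rev] at hir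
  exact (mul_eq_zero.1 hir).resolve_right (hl _)

theorem eq_zero_of_left_mul (hL : IsFullAntidiag L) {p : Type*} {M : Matrix (Fin b) p ℝ}
    (h : L * M = 0) : M = 0 := by
  obtain ⟨rfl, l, hl, rfl⟩ := hL
  ext r j
  have hrj : (antidiag l * M) (Fin.rev r) j = 0 := congrFun (congrFun h (Fin.rev r)) j
  rw [antidiag_mul_apply] at hrj
  exact (mul_eq_zero.1 hrj).resolve_left (hl _)

theorem eq_zero_of_mul_eq_mul (hL : IsFullAntidiag L) {A : Matrix (Fin a) (Fin a) ℝ}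
    {B : Matrix (Fin b) (Fin b) ℝ} (hA : A ∈ ut (Fin a)) (hB : B ∈ ut (Fin b))
    (h : A * L = L * B) : A = 0 ∧ B = 0 := by
  have hB0 : B = 0 := by
    obtain ⟨rfl, l, hl, rfl⟩ := hL
    ext r q
    rcases le_or_gt q r with hqr | hqr
    · exact hB r q hqr
    · have hrq : (A * antidiag l) (Fin.rev r) q = (antidiag l * B) (Fin.rev r) q :=
        congrFun (congrFun h (Fin.rev r)) q
      rw [mul_antidiag_apply, antidiag_mul_apply, hA _ _ (Fin.rev_le_rev.2 hqr.le), zero_mul] at hrq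
      exact (mul_eq_zero.1 hrq.symm).resolve_left (hl r)
  exact ⟨hL.eq_zero_of_mul (by rw [h, hB0, Matrix.mul_zero]), hB0⟩

theorem isAntidiag_iff (hL : IsFullAntidiag L) {D : Matrix (Fin b) (Fin a) ℝ} :
    IsAntidiag D ↔ (D * L).IsUpperTriangular ∧ (L * D).IsUpperTriangular := by
  obtain ⟨rfl, l, hl, rfl⟩ := hL
  change IsAntidiag D ↔ (D * antidiag l).IsUpperTriangular ∧ (antidiag l * D).IsUpperTriangular
  constructor
  · intro h
    refine ⟨fun i r (hri : r < i) => ?_, fun i r (hri : r < i) => ?_⟩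
    · rw [mul_antidiag_apply, h _ _ (by rw [Fin.val_rev]; omega), zero_mul]
    · rw [← Fin.rev_rev i, antidiag_mul_apply, h _ _ (by rw [Fin.val_rev]; omega), mul_zero]
  · rintro ⟨h₁, h₂⟩ r q hrq
    rcases lt_or_gt_of_ne hrq with hlt | hlt
    · have hz : (antidiag l * D) (Fin.rev r) q = 0 :=
        h₂ (show q < Fin.rev r from Fin.lt_def.2 (by rw [Fin.val_rev]; omega))
      rw [antidiag_mul_apply] at hz
      exact (mul_eq_zero.1 hz).resolve_left (hl r)
    · have hz : (D * antidiag l) r (Fin.rev q) = 0 :=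
        h₁ (show Fin.rev q < r from Fin.lt_def.2 (by rw [Fin.val_rev]; omega))
      rw [mul_antidiag_apply, Fin.rev_rev] at hz
      exact (mul_eq_zero.1 hz).resolve_right (hl _)

end IsFullAntidiag

end Antidiagonal

section Stabilizer

variable {m k : ℕ}

/-- The matrix with the given blocks in the places `(8, 0)`, `(5, 3)`, `(6, 1)`, `(7, 2)`, `(7, 6)`
of the nonzero blocks of `fMat` and zeros elsewhere. -/
def fBlocks (L₁ : Matrix (Fin (size m k 8)) (Fin (size m k 0)) ℝ)
    (L₂ : Matrix (Fin (size m k 5)) (Fin (size m k 3)) ℝ)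
    (g₁ : Matrix (Fin (size m k 6)) (Fin (size m k 1)) ℝ)
    (g₂ : Matrix (Fin (size m k 7)) (Fin (size m k 2)) ℝ)
    (g₃ : Matrix (Fin (size m k 7)) (Fin (size m k 6)) ℝ) : Matrix (Idx m k) (Idx m k) ℝ :=
  inBlock 8 0 L₁ + inBlock 5 3 L₂ + inBlock 6 1 g₁ + inBlock 7 2 g₂ + inBlock 7 6 g₃

section FBlocks

variable (L₁ : Matrix (Fin (size m k 8)) (Fin (size m k 0)) ℝ)
  (L₂ : Matrix (Fin (size m k 5)) (Fin (size m k 3)) ℝ)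
  (g₁ : Matrix (Fin (size m k 6)) (Fin (size m k 1)) ℝ)
  (g₂ : Matrix (Fin (size m k 7)) (Fin (size m k 2)) ℝ)
  (g₃ : Matrix (Fin (size m k 7)) (Fin (size m k 6)) ℝ)
  (x : Matrix (Idx m k) (Idx m k) ℝ)

theorem blk_mul_fBlocks_zero (a : Fin 9) :
    blk (x * fBlocks L₁ L₂ g₁ g₂ g₃) a 0 = blk x a 8 * L₁ := by
  simp [fBlocks, Matrix.mul_add, blk_add, blk_mul_inBlock_self, blk_mul_inBlock_of_ne]

theorem blk_mul_fBlocks_one (a : Fin 9) :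
    blk (x * fBlocks L₁ L₂ g₁ g₂ g₃) a 1 = blk x a 6 * g₁ := by
  simp [fBlocks, Matrix.mul_add, blk_add, blk_mul_inBlock_self, blk_mul_inBlock_of_ne]

theorem blk_mul_fBlocks_two (a : Fin 9) :
    blk (x * fBlocks L₁ L₂ g₁ g₂ g₃) a 2 = blk x a 7 * g₂ := by
  simp [fBlocks, Matrix.mul_add, blk_add, blk_mul_inBlock_self, blk_mul_inBlock_of_ne]

theorem blk_mul_fBlocks_three (a : Fin 9) :
    blk (x * fBlocks L₁ L₂ g₁ g₂ g₃) a 3 = blk x a 5 * L₂ := by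
  simp [fBlocks, Matrix.mul_add, blk_add, blk_mul_inBlock_self, blk_mul_inBlock_of_ne]

theorem blk_mul_fBlocks_six (a : Fin 9) :
    blk (x * fBlocks L₁ L₂ g₁ g₂ g₃) a 6 = blk x a 7 * g₃ := by
  simp [fBlocks, Matrix.mul_add, blk_add, blk_mul_inBlock_self, blk_mul_inBlock_of_ne]

theorem blk_mul_fBlocks_eq_zero (a : Fin 9) :
    ∀ b ∈ ({4, 5, 7, 8} : Finset (Fin 9)), blk (x * fBlocks L₁ L₂ g₁ g₂ g₃) a b = 0 := by
  simp [fBlocks, Matrix.mul_add, blk_add, blk_mul_inBlock_of_ne]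

theorem blk_fBlocks_mul_eight (b : Fin 9) :
    blk (fBlocks L₁ L₂ g₁ g₂ g₃ * x) 8 b = L₁ * blk x 0 b := by
  simp [fBlocks, Matrix.add_mul, blk_add, blk_inBlock_mul_self, blk_inBlock_mul_of_ne]

theorem blk_fBlocks_mul_five (b : Fin 9) :
    blk (fBlocks L₁ L₂ g₁ g₂ g₃ * x) 5 b = L₂ * blk x 3 b := by
  simp [fBlocks, Matrix.add_mul, blk_add, blk_inBlock_mul_self, blk_inBlock_mul_of_ne]

theorem blk_fBlocks_mul_six (b : Fin 9) :
    blk (fBlocks L₁ L₂ g₁ g₂ g₃ * x) 6 b = g₁ * blk x 1 b := by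
  simp [fBlocks, Matrix.add_mul, blk_add, blk_inBlock_mul_self, blk_inBlock_mul_of_ne]

theorem blk_fBlocks_mul_seven (b : Fin 9) :
    blk (fBlocks L₁ L₂ g₁ g₂ g₃ * x) 7 b = g₂ * blk x 2 b + g₃ * blk x 6 b := by
  simp [fBlocks, Matrix.add_mul, blk_add, blk_inBlock_mul_self, blk_inBlock_mul_of_ne]

theorem blk_fBlocks_mul_eq_zero (b : Fin 9) :
    ∀ a < 5, blk (fBlocks L₁ L₂ g₁ g₂ g₃ * x) a b = 0 := by
  intro a ha
  have hne : ∀ c : Fin 9, 5 ≤ c → c ≠ a := fun c hc => (ha.trans_le hc).ne'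
  simp [fBlocks, Matrix.add_mul, blk_add, blk_inBlock_mul_of_ne, hne]

end FBlocks

end Stabilizer

/-! ### The stabilizer of `f` -/

section StabilizerShape

variable {m k : ℕ}

/-- The places of the nonzero blocks of the elements of `𝔤^f`. -/
def stabBlocks : Finset (Fin 9 × Fin 9) :=
  {(0, 8), (1, 2), (1, 6), (1, 7), (2, 7), (3, 5), (6, 7)}

theorem blk_self_eq_zero_of_mem_ut {x : Matrix (Idx m k) (Idx m k) ℝ} (hx : x ∈ ut (Idx m k))
    {b : Fin 9} (hb : size m k b = 1) : blk x b b = 0 := by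
  ext r q
  have : Subsingleton (Fin (size m k b)) := by rw [hb]; infer_instance
  exact blk_apply_eq_zero_of_mem_ut hx (Subsingleton.elim q r).le

theorem isUpperTriangular_blk_self {b : Fin 9} (hb : size m k b = 1)
    (M : Matrix (Idx m k) (Idx m k) ℝ) : (blk M b b).IsUpperTriangular := by
  have : Subsingleton (Fin (size m k b)) := by rw [hb]; infer_instance
  exact fun r q hqr => absurd (Subsingleton.elim q r) hqr.ne

variable {L₁ : Matrix (Fin (size m k 8)) (Fin (size m k 0)) ℝ}
  {L₂ : Matrix (Fin (size m k 5)) (Fin (size m k 3)) ℝ}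
  {g₁ : Matrix (Fin (size m k 6)) (Fin (size m k 1)) ℝ}
  {g₂ : Matrix (Fin (size m k 7)) (Fin (size m k 2)) ℝ}
  {g₃ : Matrix (Fin (size m k 7)) (Fin (size m k 6)) ℝ}
  {x : Matrix (Idx m k) (Idx m k) ℝ}

section Equations

variable (hx : x ∈ coadStabAlgebra (fBlocks L₁ L₂ g₁ g₂ g₃))
include hx

theorem blk_mul_fBlocks_eq {a b : Fin 9} (hba : b < a) :
    blk (x * fBlocks L₁ L₂ g₁ g₂ g₃) a b = blk (fBlocks L₁ L₂ g₁ g₂ g₃ * x) a b :=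
  sub_eq_zero.1 (blk_eq_zero_of_isUpperTriangular hx.2 hba)

theorem blk_six_seven_mul_eq : blk x 6 7 * g₂ = g₁ * blk x 1 2 := by
  have h := blk_mul_fBlocks_eq hx (show (2 : Fin 9) < 6 by decide)
  rwa [blk_mul_fBlocks_two, blk_fBlocks_mul_six] at h

theorem blk_five_five_eq_zero (hL₂ : IsFullAntidiag L₂) : blk x 5 5 = 0 ∧ blk x 3 3 = 0 := by
  refine hL₂.eq_zero_of_mul_eq_mul (fun _ _ => blk_apply_eq_zero_of_mem_ut hx.1)
    (fun _ _ => blk_apply_eq_zero_of_mem_ut hx.1) ?_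
  have h := blk_mul_fBlocks_eq hx (show (3 : Fin 9) < 5 by decide)
  rwa [blk_mul_fBlocks_three, blk_fBlocks_mul_five] at h

theorem blk_eight_eight_eq_zero (hL₁ : IsFullAntidiag L₁) : blk x 8 8 = 0 ∧ blk x 0 0 = 0 := by
  refine hL₁.eq_zero_of_mul_eq_mul (fun _ _ => blk_apply_eq_zero_of_mem_ut hx.1)
    (fun _ _ => blk_apply_eq_zero_of_mem_ut hx.1) ?_
  have h := blk_mul_fBlocks_eq hx (show (0 : Fin 9) < 8 by decide)
  rwa [blk_mul_fBlocks_zero, blk_fBlocks_mul_eight] at h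

theorem blk_mul_fBlocks_eq_zero_of_lt_six {a b : Fin 9} (hba : b < a) (ha : a < 6)
    (h : blk x 3 b = 0) : blk (x * fBlocks L₁ L₂ g₁ g₂ g₃) a b = 0 := by
  rw [blk_mul_fBlocks_eq hx hba]
  rcases eq_or_ne a 5 with rfl | h5
  · rw [blk_fBlocks_mul_five, h, Matrix.mul_zero]
  · exact blk_fBlocks_mul_eq_zero _ _ _ _ _ _ _ a (by omega)

theorem blk_col_eight_eq_zero (hL₁ : IsFullAntidiag L₁) {a : Fin 9} (ha : 0 < a) :
    blk x a 8 = 0 := by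
  rcases eq_or_ne a 8 with rfl | ha8
  · exact (blk_eight_eight_eq_zero hx hL₁).1
  refine hL₁.eq_zero_of_mul ?_
  rw [← blk_mul_fBlocks_zero L₁ L₂ g₁ g₂ g₃]
  have hlow : ∀ c : Fin 9, 0 < c → blk x c 0 = 0 := fun c => blk_eq_zero_of_mem_ut hx.1
  rcases lt_or_ge a 6 with ha6 | ha6
  · exact blk_mul_fBlocks_eq_zero_of_lt_six hx ha ha6 (hlow 3 (by decide))
  rw [blk_mul_fBlocks_eq hx ha]
  obtain rfl | rfl : a = 6 ∨ a = 7 := by revert a; decide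
  · rw [blk_fBlocks_mul_six, hlow 1 (by decide), Matrix.mul_zero]
  · rw [blk_fBlocks_mul_seven, hlow 2 (by decide), hlow 6 (by decide), Matrix.mul_zero,
      Matrix.mul_zero, add_zero]

theorem blk_col_six_eq_zero (hg₁ : IsFullAntidiag g₁) {a : Fin 9} (ha : 1 < a) :
    blk x a 6 = 0 := by
  rcases lt_trichotomy a 6 with ha6 | rfl | ha6
  · refine hg₁.eq_zero_of_mul ?_
    rw [← blk_mul_fBlocks_one L₁ L₂ g₁ g₂ g₃]
    exact blk_mul_fBlocks_eq_zero_of_lt_six hx ha ha6 (blk_eq_zero_of_mem_ut hx.1 (by decide))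
  · exact blk_self_eq_zero_of_mem_ut hx.1 rfl
  · exact blk_eq_zero_of_mem_ut hx.1 ha6

theorem blk_col_seven_eq_zero (hg₂ : IsFullAntidiag g₂) {a : Fin 9} (ha : 2 < a) (ha6 : a ≠ 6) :
    blk x a 7 = 0 := by
  rcases lt_trichotomy a 7 with ha7 | rfl | ha7
  · refine hg₂.eq_zero_of_mul ?_
    rw [← blk_mul_fBlocks_two L₁ L₂ g₁ g₂ g₃]
    exact blk_mul_fBlocks_eq_zero_of_lt_six hx ha (by revert a; decide)
      (blk_eq_zero_of_mem_ut hx.1 (by decide))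
  · exact blk_self_eq_zero_of_mem_ut hx.1 rfl
  · exact blk_eq_zero_of_mem_ut hx.1 ha7

theorem blk_col_five_eq_zero (hL₂ : IsFullAntidiag L₂) {a : Fin 9} (ha : 3 < a) :
    blk x a 5 = 0 := by
  rcases lt_trichotomy a 5 with ha5 | rfl | ha5
  · refine hL₂.eq_zero_of_mul ?_
    rw [← blk_mul_fBlocks_three L₁ L₂ g₁ g₂ g₃]
    exact blk_mul_fBlocks_eq_zero_of_lt_six hx ha (ha5.trans (by decide))
      (blk_five_five_eq_zero hx hL₂).2
  · exact (blk_five_five_eq_zero hx hL₂).1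
  · exact blk_eq_zero_of_mem_ut hx.1 ha5

theorem blk_fBlocks_mul_eq_zero_of_pos (hL₂ : IsFullAntidiag L₂) (hg₁ : IsFullAntidiag g₁)
    (hg₂ : IsFullAntidiag g₂) {a b : Fin 9} (hb : 0 < b) (hba : b < a) (hab : (a, b) ≠ (6, 2)) :
    blk (fBlocks L₁ L₂ g₁ g₂ g₃ * x) a b = 0 := by
  rw [← blk_mul_fBlocks_eq hx hba]
  obtain hb | rfl | rfl | rfl | rfl :
      b ∈ ({4, 5, 7, 8} : Finset (Fin 9)) ∨ b = 1 ∨ b = 2 ∨ b = 3 ∨ b = 6 := by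
    revert a b; decide
  · exact blk_mul_fBlocks_eq_zero _ _ _ _ _ _ _ b hb
  · rw [blk_mul_fBlocks_one, blk_col_six_eq_zero hx hg₁ hba, Matrix.zero_mul]
  · rw [blk_mul_fBlocks_two, blk_col_seven_eq_zero hx hg₂ hba (by simpa using hab),
      Matrix.zero_mul]
  · rw [blk_mul_fBlocks_three, blk_col_five_eq_zero hx hL₂ hba, Matrix.zero_mul]
  · rw [blk_mul_fBlocks_six, blk_col_seven_eq_zero hx hg₂ (hba.trans' (by decide)) hba.ne',
      Matrix.zero_mul]

theorem blk_eq_zero_of_notMem_stabBlocks (hL₁ : IsFullAntidiag L₁) (hL₂ : IsFullAntidiag L₂)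
    (hg₁ : IsFullAntidiag g₁) (hg₂ : IsFullAntidiag g₂) {a b : Fin 9}
    (hab : (a, b) ∉ stabBlocks) : blk x a b = 0 := by
  have hrow {a b : Fin 9} (hb : 0 < b) (hba : b < a) (hab : (a, b) ≠ (6, 2)) :=
    blk_fBlocks_mul_eq_zero_of_pos hx hL₂ hg₁ hg₂ hb hba hab
  have hcases : b < a ∨ (a = b ∧ a ∈ ({0, 1, 2, 3, 4} : Finset (Fin 9))) ∨ (b = 8 ∧ 0 < a) ∨
      (b = 6 ∧ 1 < a) ∨ (b = 7 ∧ 2 < a ∧ a ≠ 6) ∨ (b = 5 ∧ 3 < a) ∨ (a = 0 ∧ 0 < b ∧ b < 8) ∨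
      (a = 1 ∧ 2 < b ∧ b < 6) ∨ (a = 2 ∧ 2 < b ∧ b < 6) ∨ (a = 3 ∧ b = 4) := by
    revert a b; decide
  rcases hcases with h | ⟨rfl, h⟩ | ⟨rfl, h⟩ | ⟨rfl, h⟩ | ⟨rfl, h, h'⟩ | ⟨rfl, h⟩ | ⟨rfl, hb, h⟩ |
    ⟨rfl, hb, h⟩ | ⟨rfl, hb, h⟩ | ⟨rfl, rfl⟩
  · exact blk_eq_zero_of_mem_ut hx.1 h
  · obtain rfl | rfl | h : a = 0 ∨ a = 3 ∨ a ∈ ({1, 2, 4} : Finset (Fin 9)) := by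
      revert a; decide
    · exact (blk_eight_eight_eq_zero hx hL₁).2
    · exact (blk_five_five_eq_zero hx hL₂).2
    · refine blk_self_eq_zero_of_mem_ut hx.1 ?_
      obtain rfl | rfl | rfl : a = 1 ∨ a = 2 ∨ a = 4 := by simpa using h
      all_goals rfl
  · exact blk_col_eight_eq_zero hx hL₁ h
  · exact blk_col_six_eq_zero hx hg₁ h
  · exact blk_col_seven_eq_zero hx hg₂ h h'
  · exact blk_col_five_eq_zero hx hL₂ h
  · have h8 := hrow (a := 8) hb h (by simp)
    rw [blk_fBlocks_mul_eight] at h8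
    exact hL₁.eq_zero_of_left_mul h8
  · have h6 := hrow (a := 6) (hb.trans' (by decide)) h (by simpa using hb.ne')
    rw [blk_fBlocks_mul_six] at h6
    exact hg₁.eq_zero_of_left_mul h6
  · have h7 := hrow (a := 7) (hb.trans' (by decide)) (h.trans (by decide)) (by simp)
    rw [blk_fBlocks_mul_seven, blk_eq_zero_of_mem_ut hx.1 h, Matrix.mul_zero, add_zero] at h7
    exact hg₂.eq_zero_of_left_mul h7
  · have h5 := hrow (a := 5) (b := 4) (by decide) (by decide) (by simp)
    rw [blk_fBlocks_mul_five] at h5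
    exact hL₂.eq_zero_of_left_mul h5

theorem isAntidiag_of_mem_coadStabAlgebra (hL₁ : IsFullAntidiag L₁) (hL₂ : IsFullAntidiag L₂) :
    IsAntidiag (blk x 0 8) ∧ IsAntidiag (blk x 3 5) := by
  have hdiag := (isUpperTriangular_iff_blk.1 hx.2).2
  have h0 := hdiag 0
  have h8 := hdiag 8
  have h3 := hdiag 3
  have h5 := hdiag 5
  rw [blk_sub, blk_mul_fBlocks_zero, blk_fBlocks_mul_eq_zero _ _ _ _ _ _ _ 0 (by decide),
    sub_zero] at h0
  rw [blk_sub, blk_mul_fBlocks_three, blk_fBlocks_mul_eq_zero _ _ _ _ _ _ _ 3 (by decide),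
    sub_zero] at h3
  rw [blk_sub, blk_fBlocks_mul_eight, blk_mul_fBlocks_eq_zero _ _ _ _ _ _ _ 8 (by decide),
    zero_sub] at h8
  rw [blk_sub, blk_fBlocks_mul_five, blk_mul_fBlocks_eq_zero _ _ _ _ _ _ _ 5 (by decide),
    zero_sub] at h5
  exact ⟨hL₁.isAntidiag_iff.2 ⟨h0, by simpa using h8.neg⟩,
    hL₂.isAntidiag_iff.2 ⟨h3, by simpa using h5.neg⟩⟩

end Equations

/-- The description of `𝔤^f` by blocks, for the matrix `f` with entries `γ₁` and `γ₂` in the blocks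
`(6, 1)` and `(7, 2)`. -/
structure HasStabShape (γ₁ γ₂ : ℝ) (x : Matrix (Idx m k) (Idx m k) ℝ) : Prop where
  blk_eq_zero : ∀ a b, (a, b) ∉ stabBlocks → blk x a b = 0
  isAntidiag_zero_eight : IsAntidiag (blk x 0 8)
  isAntidiag_three_five : IsAntidiag (blk x 3 5)
  relation : γ₁ * x (pos 1 (0 : Fin 1)) (pos 2 (0 : Fin 1)) =
    γ₂ * x (pos 6 (0 : Fin 1)) (pos 7 (0 : Fin 1))

namespace HasStabShape

variable {γ₁ γ₂ : ℝ} (hs : HasStabShape γ₁ γ₂ x) {a b : Fin 9}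
include hs

theorem blk_mul_fBlocks_eq_zero (hba : b < a) (hab : (a, b) ≠ (6, 2)) :
    blk (x * fBlocks L₁ L₂ g₁ g₂ g₃) a b = 0 := by
  have hcases : b ∈ ({4, 5, 7, 8} : Finset (Fin 9)) ∨ (b = 0 ∧ (a, 8) ∉ stabBlocks) ∨
      (b = 1 ∧ (a, 6) ∉ stabBlocks) ∨ (b = 2 ∧ (a, 7) ∉ stabBlocks) ∨
      (b = 3 ∧ (a, 5) ∉ stabBlocks) ∨ (b = 6 ∧ (a, 7) ∉ stabBlocks) := by
    revert a b; decide
  rcases hcases with h | ⟨rfl, h⟩ | ⟨rfl, h⟩ | ⟨rfl, h⟩ | ⟨rfl, h⟩ | ⟨rfl, h⟩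
  · exact Subregular.blk_mul_fBlocks_eq_zero _ _ _ _ _ _ _ b h
  · rw [blk_mul_fBlocks_zero, hs.blk_eq_zero _ _ h, Matrix.zero_mul]
  · rw [blk_mul_fBlocks_one, hs.blk_eq_zero _ _ h, Matrix.zero_mul]
  · rw [blk_mul_fBlocks_two, hs.blk_eq_zero _ _ h, Matrix.zero_mul]
  · rw [blk_mul_fBlocks_three, hs.blk_eq_zero _ _ h, Matrix.zero_mul]
  · rw [blk_mul_fBlocks_six, hs.blk_eq_zero _ _ h, Matrix.zero_mul]

theorem blk_fBlocks_mul_eq_zero (hba : b < a) (hab : (a, b) ≠ (6, 2)) :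
    blk (fBlocks L₁ L₂ g₁ g₂ g₃ * x) a b = 0 := by
  have hcases : a < 5 ∨ (a = 8 ∧ (0, b) ∉ stabBlocks) ∨ (a = 5 ∧ (3, b) ∉ stabBlocks) ∨
      (a = 6 ∧ (1, b) ∉ stabBlocks) ∨
      (a = 7 ∧ (2, b) ∉ stabBlocks ∧ (6, b) ∉ stabBlocks) := by
    revert a b; decide
  rcases hcases with h | ⟨rfl, h⟩ | ⟨rfl, h⟩ | ⟨rfl, h⟩ | ⟨rfl, h, h'⟩
  · exact Subregular.blk_fBlocks_mul_eq_zero _ _ _ _ _ _ b a h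
  · rw [blk_fBlocks_mul_eight, hs.blk_eq_zero _ _ h, Matrix.mul_zero]
  · rw [blk_fBlocks_mul_five, hs.blk_eq_zero _ _ h, Matrix.mul_zero]
  · rw [blk_fBlocks_mul_six, hs.blk_eq_zero _ _ h, Matrix.mul_zero]
  · rw [blk_fBlocks_mul_seven, hs.blk_eq_zero _ _ h, hs.blk_eq_zero _ _ h', Matrix.mul_zero,
      Matrix.mul_zero, add_zero]

theorem isUpperTriangular_blk_mul_fBlocks (hL₁ : IsFullAntidiag L₁) (hL₂ : IsFullAntidiag L₂)
    (b : Fin 9) : (blk (x * fBlocks L₁ L₂ g₁ g₂ g₃) b b).IsUpperTriangular := by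
  have hb : b ∈ ({4, 5, 7, 8} : Finset (Fin 9)) ∨ b = 0 ∨ b = 3 ∨ b = 1 ∨ b = 2 ∨ b = 6 := by
    revert b; decide
  rcases hb with h | rfl | rfl | h
  · rw [Subregular.blk_mul_fBlocks_eq_zero _ _ _ _ _ _ _ b h]
    exact Matrix.blockTriangular_zero
  · rw [blk_mul_fBlocks_zero]
    exact (hL₁.isAntidiag_iff.1 hs.isAntidiag_zero_eight).1
  · rw [blk_mul_fBlocks_three]
    exact (hL₂.isAntidiag_iff.1 hs.isAntidiag_three_five).1
  · exact isUpperTriangular_blk_self (by rcases h with rfl | rfl | rfl <;> rfl) _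

theorem isUpperTriangular_blk_fBlocks_mul (hL₁ : IsFullAntidiag L₁) (hL₂ : IsFullAntidiag L₂)
    (b : Fin 9) : (blk (fBlocks L₁ L₂ g₁ g₂ g₃ * x) b b).IsUpperTriangular := by
  have hb : b < 5 ∨ b = 8 ∨ b = 5 ∨ b = 6 ∨ b = 7 := by omega
  rcases hb with h | rfl | rfl | h
  · rw [Subregular.blk_fBlocks_mul_eq_zero _ _ _ _ _ _ b b h]
    exact Matrix.blockTriangular_zero
  · rw [blk_fBlocks_mul_eight]
    exact (hL₁.isAntidiag_iff.1 hs.isAntidiag_zero_eight).2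
  · rw [blk_fBlocks_mul_five]
    exact (hL₂.isAntidiag_iff.1 hs.isAntidiag_three_five).2
  · exact isUpperTriangular_blk_self (by rcases h with rfl | rfl <;> rfl) _

theorem mem_coadStabAlgebra (hL₁ : IsFullAntidiag L₁) (hL₂ : IsFullAntidiag L₂)
    (hrel : blk x 6 7 * g₂ = g₁ * blk x 1 2) : x ∈ coadStabAlgebra (fBlocks L₁ L₂ g₁ g₂ g₃) := by
  refine ⟨mem_ut_of_blk fun a b hba => hs.blk_eq_zero a b ?_,
    isUpperTriangular_iff_blk.2 ⟨fun a b hba => ?_, fun b => ?_⟩⟩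
  · revert a b; decide
  · rw [blk_sub, sub_eq_zero]
    rcases eq_or_ne (a, b) (6, 2) with hab | hab
    · obtain ⟨rfl, rfl⟩ := Prod.mk.inj hab
      rw [blk_mul_fBlocks_two, blk_fBlocks_mul_six, hrel]
    · rw [hs.blk_mul_fBlocks_eq_zero hba hab, hs.blk_fBlocks_mul_eq_zero hba hab]
  · exact (hs.isUpperTriangular_blk_mul_fBlocks hL₁ hL₂ b).sub
      (hs.isUpperTriangular_blk_fBlocks_mul hL₁ hL₂ b)

end HasStabShape

theorem fMat_eq (l₁ : Fin m → ℝ) (l₂ : Fin k → ℝ) (γ₁ γ₂ γ₃ : ℝ) :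
    fMat l₁ l₂ γ₁ γ₂ γ₃ = fBlocks (antidiag l₁) (antidiag l₂)
      (antidiag fun _ : Fin 1 => γ₁) (antidiag fun _ : Fin 1 => γ₂)
      (antidiag fun _ : Fin 1 => γ₃) := by
  have h₁ : inBlock 8 0 (antidiag l₁) = ∑ r : Fin m,
      Matrix.single (pos 8 (Fin.rev r) : Idx m k) (pos 0 r) (l₁ r) :=
    (inBlock_sum _ 8 0 _).trans (Finset.sum_congr rfl fun r _ => inBlock_single 8 0 _ _ _)
  have h₂ : inBlock 5 3 (antidiag l₂) = ∑ r : Fin k,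
      Matrix.single (pos 5 (Fin.rev r) : Idx m k) (pos 3 r) (l₂ r) :=
    (inBlock_sum _ 5 3 _).trans (Finset.sum_congr rfl fun r _ => inBlock_single 5 3 _ _ _)
  have h₃ : inBlock 6 1 (antidiag fun _ : Fin 1 => γ₁) =
      Matrix.single (pos 6 (0 : Fin 1) : Idx m k) (pos 1 (0 : Fin 1)) γ₁ :=
    (congrArg (inBlock 6 1) (Fin.sum_univ_one _)).trans (inBlock_single 6 1 _ _ _)
  have h₄ : inBlock 7 2 (antidiag fun _ : Fin 1 => γ₂) =
      Matrix.single (pos 7 (0 : Fin 1) : Idx m k) (pos 2 (0 : Fin 1)) γ₂ :=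
    (congrArg (inBlock 7 2) (Fin.sum_univ_one _)).trans (inBlock_single 7 2 _ _ _)
  have h₅ : inBlock 7 6 (antidiag fun _ : Fin 1 => γ₃) =
      Matrix.single (pos 7 (0 : Fin 1) : Idx m k) (pos 6 (0 : Fin 1)) γ₃ :=
    (congrArg (inBlock 7 6) (Fin.sum_univ_one _)).trans (inBlock_single 7 6 _ _ _)
  rw [fMat, ← h₁, ← h₂, ← h₃, ← h₄, ← h₅]
  rfl

theorem mem_coadStabAlgebra_fMat_iff {l₁ : Fin m → ℝ} {l₂ : Fin k → ℝ} {γ₁ γ₂ : ℝ}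
    (hl₁ : ∀ r, l₁ r ≠ 0) (hl₂ : ∀ r, l₂ r ≠ 0) (hγ₁ : γ₁ ≠ 0) (hγ₂ : γ₂ ≠ 0) (γ₃ : ℝ) :
    x ∈ coadStabAlgebra (fMat l₁ l₂ γ₁ γ₂ γ₃) ↔ HasStabShape γ₁ γ₂ x := by
  have hL₁ := isFullAntidiag_antidiag hl₁
  have hL₂ := isFullAntidiag_antidiag hl₂
  rw [fMat_eq]
  constructor
  · intro hx
    have hanti := isAntidiag_of_mem_coadStabAlgebra hx hL₁ hL₂
    refine ⟨fun a b => blk_eq_zero_of_notMem_stabBlocks hx hL₁ hL₂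
      (isFullAntidiag_antidiag fun _ => hγ₁) (isFullAntidiag_antidiag fun _ => hγ₂),
      hanti.1, hanti.2, (mul_antidiag_eq_antidiag_mul_iff (blk x 6 7) (blk x 1 2) _ _).1
        (blk_six_seven_mul_eq hx)⟩
  · exact fun hs => hs.mem_coadStabAlgebra hL₁ hL₂
      ((mul_antidiag_eq_antidiag_mul_iff (blk x 6 7) (blk x 1 2) _ _).2 hs.relation)

end StabilizerShape

/-! ### The zero set of `I'` -/

section ZeroSet

variable {m k : ℕ}

instance (p : Fin 9 × Fin 9) : Decidable (p ∈ bullets) := by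
  unfold bullets
  infer_instance

theorem mem_zeroSet_I'_iff {γ₁ γ₂ : ℝ} {g : UT (Idx m k)} :
    g ∈ zeroSet (d₁ m k) (I' m k γ₁ γ₂) ↔ evalAt g (d₁ m k) ≠ 0 ∧
      (∀ φ ∈ S₀ m k, evalAt g φ = 0) ∧
      (∀ i j, (i, j) ∈ bullets → ∀ r q, evalAt g (ΔTilde m k i j r q) = 0) ∧
      ∀ φ ∈ S₂ m k γ₁ γ₂, evalAt g φ = 0 := by
  rw [I', mem_zeroSet_span_iff, ← exists_prop]
  refine exists_congr fun hd => ?_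
  set L := IsLocalization.Away.lift (S := RegFun' m k) (d₁ m k) (g := evalAt g) hd.isUnit
  have hL (φ) : L (algebraMap _ _ φ) = evalAt g φ := IsLocalization.Away.lift_eq _ _ _
  have hcTilde (i j r q) : L (cTilde m k i j r q) = 0 ↔ evalAt g (ΔTilde m k i j r q) = 0 := by
    rw [cTilde, map_mul, hL, mul_eq_zero, or_iff_right ((Units.isUnit _).map L).ne_zero]
  have hS₁ : (∀ φ ∈ S₁ m k, L φ = 0) ↔
      ∀ i j, (i, j) ∈ bullets → ∀ r q, evalAt g (ΔTilde m k i j r q) = 0 := by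
    constructor
    · exact fun h i j hij r q => (hcTilde i j r q).1 (h _ ⟨i, j, hij, r, q, rfl⟩)
    · rintro h _ ⟨i, j, hij, r, q, rfl⟩
      exact (hcTilde i j r q).2 (h i j hij r q)
  simp only [S, Set.mem_union, or_imp, forall_and, Set.forall_mem_image, hL, hS₁, and_assoc]

theorem submatrix_sub_one_of_ne {ι κ κ' R : Type*} [DecidableEq ι] [Ring R] (M : Matrix ι ι R)
    {f : κ → ι} {g : κ' → ι} (h : ∀ s t, f s ≠ g t) :
    (M - 1).submatrix f g = M.submatrix f g := by
  ext s t
  simp [h s t]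

theorem blk_sub_one_of_ne (M : Matrix (Idx m k) (Idx m k) ℝ) {a b : Fin 9} (h : a ≠ b) :
    blk (M - 1) a b = blk M a b :=
  submatrix_sub_one_of_ne M (pos_ne_pos h)

/-- The square block of a matrix in the place given by the `s`-th pair of `Φ`. -/
def pivotBlk (Y : Matrix (Idx m k) (Idx m k) ℝ) (s : Fin 3) :
    Matrix (Fin (size m k (rowBlk s))) (Fin (size m k (rowBlk s))) ℝ :=
  (blk Y (rowBlk s) (colBlk s)).submatrix id (Fin.cast (size_rowBlk m k s))

theorem evalAt_det_pivot (g : UT (Idx m k)) (s : Fin 3) :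
    evalAt g (pivot m k s).det = (pivotBlk (mat g - 1) s).det := by
  have hne : rowBlk s ≠ colBlk s := by revert s; decide
  rw [pivotBlk, blk_sub_one_of_ne _ hne]
  exact evalAt_det_submatrix_genericMat g (pos (rowBlk s))
    fun q => pos (colBlk s) (Fin.cast (size_rowBlk m k s) q)

theorem evalAt_d₁_ne_zero_iff {g : UT (Idx m k)} :
    evalAt g (d₁ m k) ≠ 0 ↔ ∀ s, (pivotBlk (mat g - 1) s).det ≠ 0 := by
  simp only [d₁, map_mul, evalAt_det_pivot, mul_ne_zero_iff, and_assoc, Fin.forall_fin_succ]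
  simp

theorem minorRow_ne_minorCol {i j : Fin 9} (x y : MinorIdx m k i j) : minorRow x ≠ minorCol y :=
  pos_ne_pos ((by decide : ∀ s t : Fin 3, rowBlk s ≠ colBlk t) _ _) _ _

theorem det_submatrix_minor_ne_zero {Y : Matrix (Idx m k) (Idx m k) ℝ} (hY : Y ∈ ut (Idx m k))
    (hdet : ∀ s, (pivotBlk Y s).det ≠ 0) (i j : Fin 9) :
    (Y.submatrix (minorRow (i := i) (j := j)) minorCol).det ≠ 0 := by
  obtain ⟨g, rfl⟩ : ∃ g : UT (Idx m k), mat g - 1 = Y := ⟨oneAdd ⟨Y, hY⟩, mat_oneAdd_sub_one _⟩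
  rw [submatrix_sub_one_of_ne _ minorRow_ne_minorCol, ← evalAt_det_submatrix_genericMat]
  change evalAt g (Δ m k i j) ≠ 0
  rw [Δ_eq_prod, map_prod, Finset.prod_ne_zero_iff]
  exact fun s _ => by rw [evalAt_det_pivot]; exact hdet s

/-- The minor of `Y` attached to the entry in place `(r, q)` of block `(i, j)`, with the row and the
column of that entry written last as in `ΔTilde`. -/
def borderedMinor (Y : Matrix (Idx m k) (Idx m k) ℝ) (i j : Fin 9) (r : Fin (size m k i))
    (q : Fin (size m k j)) : ℝ :=
  (Y.submatrix (Sum.elim (minorRow (i := i) (j := j)) fun _ : Unit => pos i r)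
    (Sum.elim (minorCol (i := i) (j := j)) fun _ : Unit => pos j q)).det

theorem evalAt_ΔTilde (g : UT (Idx m k)) {i j : Fin 9} (hij : i ≠ j) (r : Fin (size m k i))
    (q : Fin (size m k j)) :
    evalAt g (ΔTilde m k i j r q) = borderedMinor (mat g - 1) i j r q := by
  have hlt : ∀ s : Fin 3, rowBlk s < colBlk s := by decide
  rw [borderedMinor, submatrix_sub_one_of_ne]
  · exact evalAt_det_submatrix_genericMat g _ _
  rintro (x | _) (y | _)
  · exact minorRow_ne_minorCol x y
  · exact pos_ne_pos ((hlt x.1).trans x.1.2.2).ne _ _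
  · exact pos_ne_pos (y.1.2.1.trans (hlt y.1)).ne _ _
  · exact pos_ne_pos hij r q

/-- The system `S = 0` for the matrix `Y = g - 1`, away from the zeros of `d₁`. -/
structure SatisfiesSystem (γ₁ γ₂ : ℝ) (Y : Matrix (Idx m k) (Idx m k) ℝ) : Prop where
  mem_ut : Y ∈ ut (Idx m k)
  det_pivotBlk_ne_zero : ∀ s, (pivotBlk Y s).det ≠ 0
  blk_self_eq_zero : ∀ b ∈ ({0, 3, 5, 8} : Set (Fin 9)), blk Y b b = 0
  borderedMinor_eq_zero : ∀ i j, (i, j) ∈ bullets → ∀ r q, borderedMinor Y i j r q = 0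
  blk_one_two_mul_add : blk Y 1 2 * blk Y 2 5 + blk Y 1 3 * blk Y 3 5 = 0
  blk_three_five_mul_add : blk Y 3 5 * blk Y 5 7 + blk Y 3 6 * blk Y 6 7 = 0
  relation : γ₁ * Y (pos 1 (0 : Fin 1)) (pos 2 (0 : Fin 1)) =
    γ₂ * Y (pos 6 (0 : Fin 1)) (pos 7 (0 : Fin 1))

theorem forall_S₀_iff (g : UT (Idx m k)) : (∀ φ ∈ S₀ m k, evalAt g φ = 0) ↔
    ∀ b ∈ ({0, 3, 5, 8} : Set (Fin 9)), blk (mat g - 1) b b = 0 := by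
  have heval {b : Fin 9} {r q : Fin (size m k b)} (hrq : r < q) :
      evalAt g (C m k b b r q) = blk (mat g - 1) b b r q := by
    simp [C, evalAt_genericMat, blk_apply, pos_inj, hrq.ne]
  constructor
  · intro h b hb
    ext r q
    rcases lt_or_ge r q with hrq | hrq
    · rw [← heval hrq]
      exact h _ ⟨b, hb, r, q, hrq, rfl⟩
    · exact blk_apply_eq_zero_of_mem_ut (mat_sub_one_mem_ut g) hrq
  · rintro h _ ⟨b, hb, r, q, hrq, rfl⟩
    rw [heval hrq, h b hb, Matrix.zero_apply]

theorem map_evalAt_C (g : UT (Idx m k)) {a b : Fin 9} (hab : a ≠ b) :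
    (C m k a b).map (evalAt g) = blk (mat g - 1) a b := by
  rw [blk_sub_one_of_ne _ hab]
  ext r q
  exact evalAt_genericMat g _ _

theorem forall_S₂_iff {γ₁ γ₂ : ℝ} (g : UT (Idx m k)) : (∀ φ ∈ S₂ m k γ₁ γ₂, evalAt g φ = 0) ↔
      blk (mat g - 1) 1 2 * blk (mat g - 1) 2 5 + blk (mat g - 1) 1 3 * blk (mat g - 1) 3 5 = 0 ∧
      blk (mat g - 1) 3 5 * blk (mat g - 1) 5 7 + blk (mat g - 1) 3 6 * blk (mat g - 1) 6 7 = 0 ∧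
      γ₁ * (mat g - 1) (pos 1 (0 : Fin 1)) (pos 2 (0 : Fin 1)) =
        γ₂ * (mat g - 1) (pos 6 (0 : Fin 1)) (pos 7 (0 : Fin 1)) := by
  have hentries {a b : Fin 9}
      (M : Matrix (Fin (size m k a)) (Fin (size m k b)) (RegFun (Idx m k))) :
      (∀ φ, (∃ r q, φ = M r q) → evalAt g φ = 0) ↔ M.map (evalAt g) = 0 := by
    rw [← Matrix.ext_iff]
    exact ⟨fun h r q => h _ ⟨r, q, rfl⟩, by rintro h _ ⟨r, q, rfl⟩; exact h r q⟩
  have hentry {p q : Idx m k} (hpq : p ≠ q) :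
      evalAt g (genericMat (Idx m k) p q) = (mat g - 1) p q := by
    rw [evalAt_genericMat, Matrix.sub_apply, Matrix.one_apply_ne hpq, sub_zero]
  have hrel : evalAt g (MvPolynomial.C γ₁ * C m k 1 2 (0 : Fin 1) (0 : Fin 1) -
      MvPolynomial.C γ₂ * C m k 6 7 (0 : Fin 1) (0 : Fin 1)) = 0 ↔
      γ₁ * (mat g - 1) (pos 1 (0 : Fin 1)) (pos 2 (0 : Fin 1)) =
        γ₂ * (mat g - 1) (pos 6 (0 : Fin 1)) (pos 7 (0 : Fin 1)) := by
    rw [map_sub, map_mul, map_mul, evalAt_C, evalAt_C, sub_eq_zero]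
    exact Eq.congr (congrArg _ (hentry (pos_ne_pos (by decide) _ _)))
      (congrArg _ (hentry (pos_ne_pos (by decide) _ _)))
  simp (disch := decide) only [S₂, Set.mem_union, or_imp, forall_and, Set.mem_ofPred_eq,
    hentries, and_assoc, Set.mem_singleton_iff, forall_eq, Matrix.map_add _ (map_add _),
    Matrix.map_mul, map_evalAt_C, hrel]

theorem mem_zeroSet_iff {γ₁ γ₂ : ℝ} {g : UT (Idx m k)} :
    g ∈ zeroSet (d₁ m k) (I' m k γ₁ γ₂) ↔ SatisfiesSystem γ₁ γ₂ (mat g - 1) := by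
  have hne {i j : Fin 9} (hij : (i, j) ∈ bullets) : i ≠ j := by
    rintro rfl
    revert i
    decide
  have hS₁ : (∀ i j, (i, j) ∈ bullets → ∀ r q, evalAt g (ΔTilde m k i j r q) = 0) ↔
      ∀ i j, (i, j) ∈ bullets → ∀ r q, borderedMinor (mat g - 1) i j r q = 0 :=
    forall₃_congr fun i j hij => by simp only [evalAt_ΔTilde g (hne hij)]
  rw [mem_zeroSet_I'_iff, evalAt_d₁_ne_zero_iff, forall_S₀_iff, hS₁, forall_S₂_iff g]
  exact ⟨fun ⟨h₁, h₂, h₃, h₄, h₅, h₆⟩ => ⟨mat_sub_one_mem_ut g, h₁, h₂, h₃, h₄, h₅, h₆⟩,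
    fun ⟨_, h₁, h₂, h₃, h₄, h₅, h₆⟩ => ⟨h₁, h₂, h₃, h₄, h₅, h₆⟩⟩

end ZeroSet

/-! ### Conjugates of elements of the stabilizer -/

section Saturation

variable {m k : ℕ}

theorem blk_mul_mul_of_corner {H K X : Matrix (Idx m k) (Idx m k) ℝ} (hH : H.IsUpperTriangular)
    (hK : K.IsUpperTriangular) {a b : Fin 9}
    (hX : ∀ a' b', a ≤ a' → b' ≤ b → (a', b') ≠ (a, b) → blk X a' b' = 0) :
    blk (H * X * K) a b = blk H a a * blk X a b * blk K b b := by
  have hcongr : blk (H * X * K) a b = blk (H * inBlock a b (blk X a b) * K) a b := by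
    ext r q
    refine mul_mul_apply_congr_of_isUpperTriangular hH hK fun p t hp ht => ?_
    obtain ⟨r', hr'⟩ := exists_eq_pos p
    obtain ⟨q', hq'⟩ := exists_eq_pos t
    rw [hr', hq']
    change blk X _ _ r' q' = blk (inBlock a b _) _ _ r' q'
    by_cases hab : (blkOf p, blkOf t) = (a, b)
    · obtain ⟨rfl, rfl⟩ := Prod.mk.inj hab
      rw [blk_inBlock_self]
    · rw [hX _ _ (blkOf_mono hp) (blkOf_mono ht) hab, blk_inBlock_of_ne _ (Ne.symm hab)]
  rw [hcongr, inBlock, ← transpose_inc_mul_mul_inc H, ← transpose_inc_mul_mul_inc K,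
    ← transpose_inc_mul_mul_inc (H * _ * K)]
  simp only [Matrix.mul_assoc]

theorem blk_mul_mul_eq_zero {H K X : Matrix (Idx m k) (Idx m k) ℝ} (hH : H.IsUpperTriangular)
    (hK : K.IsUpperTriangular) {a b : Fin 9} (hX : ∀ a' b', a ≤ a' → b' ≤ b → blk X a' b' = 0) :
    blk (H * X * K) a b = 0 := by
  rw [blk_mul_mul_of_corner hH hK fun a' b' ha hb _ => hX a' b' ha hb, hX a b le_rfl le_rfl,
    Matrix.mul_zero, Matrix.zero_mul]

theorem det_blk_mat (h : UT (Idx m k)) (b : Fin 9) : (blk (mat h) b b).det = 1 := by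
  rw [Matrix.det_of_isUpperTriangular ((isUpperTriangular_iff_blk.1 (isUpperTriangular_mat h)).2 b)]
  exact Finset.prod_eq_one fun r _ => mat_apply_self h _

theorem det_pivotBlk_mul_mul {H K X : Matrix (Idx m k) (Idx m k) ℝ} {s : Fin 3}
    (e : blk (H * X * K) (rowBlk s) (colBlk s) =
      blk H (rowBlk s) (rowBlk s) * blk X (rowBlk s) (colBlk s) * blk K (colBlk s) (colBlk s)) :
    (pivotBlk (H * X * K) s).det =
      (blk H (rowBlk s) (rowBlk s)).det * (pivotBlk X s).det *
        (blk K (colBlk s) (colBlk s)).det := by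
  let c := finCongr (size_rowBlk m k s)
  have hfactor : pivotBlk (H * X * K) s = blk H (rowBlk s) (rowBlk s) * pivotBlk X s *
      (blk K (colBlk s) (colBlk s)).submatrix c c := by
    rw [pivotBlk, e]
    exact (Matrix.submatrix_mul_equiv (_ * _) _ id c c).symm
  rw [hfactor, Matrix.det_mul, Matrix.det_mul, Matrix.det_submatrix_equiv_self]

theorem det_pivotBlk_zero (Y : Matrix (Idx m k) (Idx m k) ℝ) :
    (pivotBlk Y 0).det = Y (pos 1 (0 : Fin 1)) (pos 2 (0 : Fin 1)) := Matrix.det_fin_one _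

theorem det_pivotBlk_two (Y : Matrix (Idx m k) (Idx m k) ℝ) :
    (pivotBlk Y 2).det = Y (pos 6 (0 : Fin 1)) (pos 7 (0 : Fin 1)) := Matrix.det_fin_one _

namespace HasStabShape

variable {γ₁ γ₂ : ℝ} {x : Matrix (Idx m k) (Idx m k) ℝ} (hs : HasStabShape γ₁ γ₂ x)
  {a b i j : Fin 9}
include hs

theorem mem_ut : x ∈ ut (Idx m k) :=
  mem_ut_of_blk fun a b hba => hs.blk_eq_zero a b (by revert a b; decide)

theorem blk_mul_self_eq_zero (hab : (a, b) ≠ (1, 7)) : blk (x * x) a b = 0 := by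
  have hpath : ∀ a b c, (a, c) ∈ stabBlocks → (c, b) ∈ stabBlocks → (a, b) = (1, 7) := by decide
  rw [blk_mul]
  refine Finset.sum_eq_zero fun c _ => ?_
  by_cases hac : (a, c) ∈ stabBlocks
  · rw [hs.blk_eq_zero c b fun hcb => hab (hpath a b c hac hcb), Matrix.mul_zero]
  · rw [hs.blk_eq_zero a c hac, Matrix.zero_mul]

variable (h : UT (Idx m k))

theorem blk_conj_eq_zero (hab : ∀ y ∈ stabBlocks, a ≤ y.1 → ¬y.2 ≤ b) :
    blk (mat h * x * mat h⁻¹) a b = 0 :=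
  blk_mul_mul_eq_zero (isUpperTriangular_mat h) (isUpperTriangular_mat h⁻¹) fun a' b' ha hb =>
    hs.blk_eq_zero a' b' fun hmem => hab _ hmem ha hb

theorem blk_conj_mul_conj_eq_zero (hab : ¬(a ≤ 1 ∧ 7 ≤ b)) :
    blk ((mat h * x * mat h⁻¹) * (mat h * x * mat h⁻¹)) a b = 0 := by
  rw [mat_conj_mul_conj]
  refine blk_mul_mul_eq_zero (isUpperTriangular_mat h) (isUpperTriangular_mat h⁻¹)
    fun a' b' ha hb => hs.blk_mul_self_eq_zero fun e => hab ?_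
  obtain ⟨rfl, rfl⟩ := Prod.mk.inj e
  exact ⟨ha, hb⟩

theorem det_pivotBlk_conj (s : Fin 3) :
    (pivotBlk (mat h * x * mat h⁻¹) s).det = (pivotBlk x s).det := by
  have hcorner : ∀ s : Fin 3, ∀ y ∈ stabBlocks, rowBlk s ≤ y.1 → y.2 ≤ colBlk s →
      y = (rowBlk s, colBlk s) := by decide
  rw [det_pivotBlk_mul_mul (blk_mul_mul_of_corner (isUpperTriangular_mat h)
      (isUpperTriangular_mat h⁻¹) fun a b ha hb hne => hs.blk_eq_zero a b fun hmem =>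
        hne (hcorner s _ hmem ha hb)),
    det_blk_mat, det_blk_mat, one_mul, mul_one]

theorem blk_conj_one_two_mul_add :
    blk (mat h * x * mat h⁻¹) 1 2 * blk (mat h * x * mat h⁻¹) 2 5 +
      blk (mat h * x * mat h⁻¹) 1 3 * blk (mat h * x * mat h⁻¹) 3 5 = 0 := by
  have hsq := hs.blk_conj_mul_conj_eq_zero h (show ¬((1 : Fin 9) ≤ 1 ∧ 7 ≤ (5 : Fin 9)) by decide)
  rw [blk_mul, sum_fin_nine, hs.blk_conj_eq_zero h (a := 1) (b := 0) (by decide),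
    hs.blk_conj_eq_zero h (a := 1) (b := 1) (by decide),
    hs.blk_conj_eq_zero h (a := 4) (b := 5) (by decide),
    hs.blk_conj_eq_zero h (a := 5) (b := 5) (by decide),
    hs.blk_conj_eq_zero h (a := 6) (b := 5) (by decide),
    hs.blk_conj_eq_zero h (a := 7) (b := 5) (by decide),
    hs.blk_conj_eq_zero h (a := 8) (b := 5) (by decide)] at hsq
  simpa only [Matrix.mul_zero, Matrix.zero_mul, add_zero, zero_add] using hsq

theorem blk_conj_three_five_mul_add :
    blk (mat h * x * mat h⁻¹) 3 5 * blk (mat h * x * mat h⁻¹) 5 7 +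
      blk (mat h * x * mat h⁻¹) 3 6 * blk (mat h * x * mat h⁻¹) 6 7 = 0 := by
  have hsq := hs.blk_conj_mul_conj_eq_zero h (show ¬((3 : Fin 9) ≤ 1 ∧ 7 ≤ (7 : Fin 9)) by decide)
  rw [blk_mul, sum_fin_nine, hs.blk_conj_eq_zero h (a := 3) (b := 0) (by decide),
    hs.blk_conj_eq_zero h (a := 3) (b := 1) (by decide),
    hs.blk_conj_eq_zero h (a := 3) (b := 2) (by decide),
    hs.blk_conj_eq_zero h (a := 3) (b := 3) (by decide),
    hs.blk_conj_eq_zero h (a := 3) (b := 4) (by decide),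
    hs.blk_conj_eq_zero h (a := 7) (b := 7) (by decide),
    hs.blk_conj_eq_zero h (a := 8) (b := 7) (by decide)] at hsq
  simpa only [Matrix.mul_zero, Matrix.zero_mul, add_zero, zero_add] using hsq

end HasStabShape

/-- The matrix obtained from `x` by replacing the blocks outside the corner of the places `(a, b)`
with `i ≤ a` and `b ≤ j` by zeros. -/
def corner (i j : Fin 9) (x : Matrix (Idx m k) (Idx m k) ℝ) : Matrix (Idx m k) (Idx m k) ℝ :=
  fun p q => if i ≤ blkOf p ∧ blkOf q ≤ j then x p q else 0

namespace HasStabShape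

variable {γ₁ γ₂ : ℝ} {x : Matrix (Idx m k) (Idx m k) ℝ} (hs : HasStabShape γ₁ γ₂ x)
  {i j : Fin 9}
include hs

theorem mem_stabBlocks_of_corner_ne_zero {p q : Idx m k} (h : corner i j x p q ≠ 0) :
    (blkOf p, blkOf q) ∈ stabBlocks ∧ i ≤ blkOf p ∧ blkOf q ≤ j := by
  obtain ⟨r, hr⟩ := exists_eq_pos p
  obtain ⟨t, ht⟩ := exists_eq_pos q
  rw [corner, ne_eq, ite_eq_right_iff, Classical.not_imp] at h
  refine ⟨by_contra fun hmem => h.2 ?_, h.1⟩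
  rw [hr, ht]
  exact congrFun (congrFun (hs.blk_eq_zero _ _ hmem) r) t

theorem rank_corner_le_of_rows
    (h : ∀ y ∈ stabBlocks, i ≤ y.1 → y.2 ≤ j → ∃ s : PhiOf i j, y.1 = rowBlk s) :
    (corner i j x).rank ≤ Fintype.card (MinorIdx m k i j) := by
  refine rank_le_card_of_row_eq_zero minorRow fun p hp q => by_contra fun hne => hp ?_
  obtain ⟨hmem, hi, hj⟩ := hs.mem_stabBlocks_of_corner_ne_zero hne
  obtain ⟨s, hps⟩ := h _ hmem hi hj
  obtain ⟨b, r⟩ := p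
  obtain rfl : b = rowBlk s := hps
  exact ⟨⟨s, r⟩, rfl⟩

theorem rank_corner_le_of_cols
    (h : ∀ y ∈ stabBlocks, i ≤ y.1 → y.2 ≤ j → ∃ s : PhiOf i j, y.2 = colBlk s) :
    (corner i j x).rank ≤ Fintype.card (MinorIdx m k i j) := by
  refine rank_le_card_of_col_eq_zero minorCol fun q hq p => by_contra fun hne => hq ?_
  obtain ⟨hmem, hi, hj⟩ := hs.mem_stabBlocks_of_corner_ne_zero hne
  obtain ⟨s, hqs⟩ := h _ hmem hi hj
  obtain ⟨b, r⟩ := q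
  obtain rfl : b = colBlk s := hqs
  exact ⟨⟨s, Fin.cast (size_rowBlk m k s).symm r⟩, rfl⟩

theorem rank_corner_le (hij : (i, j) ∈ bullets) :
    (corner i j x).rank ≤ Fintype.card (MinorIdx m k i j) := by
  have hrows : ∀ i j : Fin 9, (i, j) ∈ bullets → (i, j) ≠ (2, 8) → ∀ y ∈ stabBlocks, i ≤ y.1 →
      y.2 ≤ j → ∃ s : PhiOf i j, y.1 = rowBlk s := by decide
  have hcols : ∀ y ∈ stabBlocks, 2 ≤ y.1 → y.2 ≤ 8 → ∃ s : PhiOf 2 8, y.2 = colBlk s := by decide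
  by_cases h : (i, j) = (2, 8)
  · obtain ⟨rfl, rfl⟩ := Prod.mk.inj h
    exact hs.rank_corner_le_of_cols hcols
  · exact hs.rank_corner_le_of_rows (hrows i j hij h)

theorem borderedMinor_conj_eq_zero (h : UT (Idx m k)) (hij : (i, j) ∈ bullets)
    (r : Fin (size m k i)) (q : Fin (size m k j)) :
    borderedMinor (mat h * x * mat h⁻¹) i j r q = 0 := by
  refine det_submatrix_mul_mul_eq_zero (Z := corner i j x) (isUpperTriangular_mat h)
    (isUpperTriangular_mat h⁻¹) (fun s t a b ha hb => ?_) ?_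
  · have hi : i ≤ blkOf a := by
      refine le_trans ?_ (blkOf_mono ha)
      rcases s with s | _
      exacts [s.1.2.1.le, le_rfl]
    have hj : blkOf b ≤ j := by
      refine (blkOf_mono hb).trans ?_
      rcases t with t | _
      exacts [t.1.2.2.le, le_rfl]
    exact (if_pos ⟨hi, hj⟩).symm
  · rw [Fintype.card_sum, Fintype.card_unit]
    exact Nat.lt_succ_of_le (hs.rank_corner_le hij)

theorem satisfiesSystem_conj (hdet : ∀ s, (pivotBlk x s).det ≠ 0) (h : UT (Idx m k)) :
    SatisfiesSystem γ₁ γ₂ (mat h * x * mat h⁻¹) where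
  mem_ut := mem_ut_of_blk fun a b hba => hs.blk_conj_eq_zero h (by revert a b; decide)
  det_pivotBlk_ne_zero s := by rw [hs.det_pivotBlk_conj]; exact hdet s
  blk_self_eq_zero b _ := hs.blk_conj_eq_zero h (by revert b; decide)
  borderedMinor_eq_zero i j hij := hs.borderedMinor_conj_eq_zero h hij
  blk_one_two_mul_add := hs.blk_conj_one_two_mul_add h
  blk_three_five_mul_add := hs.blk_conj_three_five_mul_add h
  relation := by
    have hrel : γ₁ * (pivotBlk x 0).det = γ₂ * (pivotBlk x 2).det := by
      rw [det_pivotBlk_zero, det_pivotBlk_two]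
      exact hs.relation
    rwa [← hs.det_pivotBlk_conj h, ← hs.det_pivotBlk_conj h, det_pivotBlk_zero,
      det_pivotBlk_two] at hrel

end HasStabShape

section NormalForm

variable (p : Matrix (Fin (size m k 1)) (Fin (size m k 2)) ℝ)
  (w : Matrix (Fin (size m k 6)) (Fin (size m k 7)) ℝ)
  (s : Matrix (Fin (size m k 1)) (Fin (size m k 6)) ℝ)
  (A : Matrix (Fin (size m k 3)) (Fin (size m k 5)) ℝ)
  (T : Matrix (Fin (size m k 0)) (Fin (size m k 8)) ℝ)

/-- The matrix with blocks `p`, `w`, `s`, `A`, `T` in the places `(1, 2)`, `(6, 7)`, `(1, 6)`,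
`(3, 5)`, `(0, 8)`. The zero set of the system consists of conjugates of elements `1 + y` for `y` of
this form. -/
def normalForm : Matrix (Idx m k) (Idx m k) ℝ :=
  inBlock 1 2 p + inBlock 6 7 w + inBlock 1 6 s + inBlock 3 5 A + inBlock 0 8 T

theorem blk_normalForm_one_two : blk (normalForm p w s A T) 1 2 = p := by
  simp (disch := decide) only [normalForm, blk_add, blk_inBlock_self, blk_inBlock_of_ne, add_zero]

theorem blk_normalForm_six_seven : blk (normalForm p w s A T) 6 7 = w := by
  simp (disch := decide) only [normalForm, blk_add, blk_inBlock_self, blk_inBlock_of_ne, add_zero,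
    zero_add]

theorem blk_normalForm_three_five : blk (normalForm p w s A T) 3 5 = A := by
  simp (disch := decide) only [normalForm, blk_add, blk_inBlock_self, blk_inBlock_of_ne, add_zero,
    zero_add]

theorem blk_normalForm_zero_eight : blk (normalForm p w s A T) 0 8 = T := by
  simp (disch := decide) only [normalForm, blk_add, blk_inBlock_self, blk_inBlock_of_ne, zero_add]

theorem blk_normalForm_eq_zero {a b : Fin 9} (hab : (a, b) ∉ stabBlocks) :
    blk (normalForm p w s A T) a b = 0 := by
  have hne : ∀ y ∈ stabBlocks, y ≠ (a, b) := fun y hy e => hab (e ▸ hy)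
  simp only [normalForm, blk_add, blk_inBlock_of_ne _ (hne (1, 2) (by decide)),
    blk_inBlock_of_ne _ (hne (6, 7) (by decide)), blk_inBlock_of_ne _ (hne (1, 6) (by decide)),
    blk_inBlock_of_ne _ (hne (3, 5) (by decide)), blk_inBlock_of_ne _ (hne (0, 8) (by decide)),
    add_zero]

variable {p w A T} in
theorem hasStabShape_normalForm {γ₁ γ₂ : ℝ} (hA : IsAntidiag A) (hT : IsAntidiag T)
    (hpw : γ₁ * p (0 : Fin 1) (0 : Fin 1) = γ₂ * w (0 : Fin 1) (0 : Fin 1)) :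
    HasStabShape γ₁ γ₂ (normalForm p w s A T) where
  blk_eq_zero _ _ := blk_normalForm_eq_zero p w s A T
  isAntidiag_zero_eight := by rwa [blk_normalForm_zero_eight]
  isAntidiag_three_five := by rwa [blk_normalForm_three_five]
  relation := by
    have h₁₂ := congrFun (congrFun (blk_normalForm_one_two p w s A T) (0 : Fin 1)) (0 : Fin 1)
    have h₆₇ := congrFun (congrFun (blk_normalForm_six_seven p w s A T) (0 : Fin 1)) (0 : Fin 1)
    rw [← h₁₂, ← h₆₇] at hpw
    exact hpw

end NormalForm

section Density

variable {γ₁ γ₂ : ℝ} {x y : Matrix (Idx m k) (Idx m k) ℝ}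

theorem HasStabShape.add_smul (hx : HasStabShape γ₁ γ₂ x) (hy : HasStabShape γ₁ γ₂ y) (c : ℝ) :
    HasStabShape γ₁ γ₂ (x + c • y) where
  blk_eq_zero a b hab := by
    rw [blk_add, hx.blk_eq_zero a b hab, zero_add]
    exact (congrArg (c • ·) (hy.blk_eq_zero a b hab)).trans (smul_zero c)
  isAntidiag_zero_eight r q h := by
    change blk x 0 8 r q + c * blk y 0 8 r q = 0
    rw [hx.isAntidiag_zero_eight r q h, hy.isAntidiag_zero_eight r q h, mul_zero, add_zero]
  isAntidiag_three_five r q h := by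
    change blk x 3 5 r q + c * blk y 3 5 r q = 0
    rw [hx.isAntidiag_three_five r q h, hy.isAntidiag_three_five r q h, mul_zero, add_zero]
  relation := by
    change γ₁ * (x _ _ + c * y _ _) = γ₂ * (x _ _ + c * y _ _)
    linear_combination hx.relation + c * hy.relation

theorem exists_hasStabShape_det_pivotBlk_ne_zero (m k : ℕ) (hγ₁ : γ₁ ≠ 0) (hγ₂ : γ₂ ≠ 0) :
    ∃ y : Matrix (Idx m k) (Idx m k) ℝ, HasStabShape γ₁ γ₂ y ∧ ∀ s, (pivotBlk y s).det ≠ 0 := by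
  let p : Matrix (Fin (size m k 1)) (Fin (size m k 2)) ℝ := antidiag fun _ : Fin 1 => γ₂
  let w : Matrix (Fin (size m k 6)) (Fin (size m k 7)) ℝ := antidiag fun _ : Fin 1 => γ₁
  let A : Matrix (Fin (size m k 3)) (Fin (size m k 5)) ℝ := antidiag fun _ : Fin k => 1
  have hpw : γ₁ * p (0 : Fin 1) (0 : Fin 1) = γ₂ * w (0 : Fin 1) (0 : Fin 1) := by
    change γ₁ * antidiag (fun _ : Fin 1 => γ₂) 0 0 = γ₂ * antidiag (fun _ : Fin 1 => γ₁) 0 0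
    simp [antidiag_apply, mul_comm]
  refine ⟨normalForm p w 0 A 0, hasStabShape_normalForm 0 (isAntidiag_antidiag _)
    (fun _ _ _ => rfl) hpw, fun s => ?_⟩
  fin_cases s
  · exact (congrArg (fun B : Matrix (Fin 1) (Fin 1) ℝ => B.det)
      (blk_normalForm_one_two p w 0 A 0)).trans_ne (det_antidiag_ne_zero fun _ => hγ₂)
  · exact (congrArg (fun B : Matrix (Fin k) (Fin k) ℝ => B.det)
      (blk_normalForm_three_five p w 0 A 0)).trans_ne (det_antidiag_ne_zero fun _ => one_ne_zero)
  · exact (congrArg (fun B : Matrix (Fin 1) (Fin 1) ℝ => B.det)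
      (blk_normalForm_six_seven p w 0 A 0)).trans_ne (det_antidiag_ne_zero fun _ => hγ₁)

theorem conj_mem_closure_zeroSet (hγ₁ : γ₁ ≠ 0) (hγ₂ : γ₂ ≠ 0) {x : UT (Idx m k)}
    (hx : HasStabShape γ₁ γ₂ (mat x - 1)) (h : UT (Idx m k)) :
    h * x * h⁻¹ ∈ closure (zeroSet (d₁ m k) (I' m k γ₁ γ₂)) := by
  obtain ⟨y, hy, hdet⟩ := exists_hasStabShape_det_pivotBlk_ne_zero m k hγ₁ hγ₂
  let path (ε : ℝ) : UT (Idx m k) :=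
    oneAdd (⟨mat x - 1, hx.mem_ut⟩ + ε • ⟨y, hy.mem_ut⟩)
  have hpath (ε : ℝ) : mat (path ε) - 1 = mat x - 1 + ε • y := mat_oneAdd_sub_one _
  have hpath_zero : path 0 = x :=
    mat_sub_one_injective ((hpath 0).trans (by rw [zero_smul, add_zero]; rfl))
  have hcont : Continuous fun ε => h * path ε * h⁻¹ :=
    (continuous_const.mul (continuous_oneAdd.comp (by fun_prop))).mul continuous_const
  have hlim : Filter.Tendsto (fun ε => h * path ε * h⁻¹) (nhdsWithin 0 {0}ᶜ)
      (nhds (h * x * h⁻¹)) := by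
    simpa only [hpath_zero] using (hcont.tendsto 0).mono_left nhdsWithin_le_nhds
  refine mem_closure_of_tendsto hlim ?_
  filter_upwards [Filter.eventually_all.2 fun s =>
    eventually_det_add_smul_ne_zero (pivotBlk (mat x - 1) s) (hdet s)] with ε hε
  have hconj : mat (h * path ε * h⁻¹) - 1 = mat h * (mat x - 1 + ε • y) * mat h⁻¹ :=
    (mat_conj_sub_one h (path ε)).trans (congrArg (mat h * · * mat h⁻¹) (hpath ε))
  rw [mem_zeroSet_iff, hconj]
  exact (hx.add_smul hy ε).satisfiesSystem_conj hε h

end Density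

end Saturation

/-! ### Columns of solutions of the system -/

section Columns

variable {m k : ℕ}

theorem exists_mat_mul_inc_eq (V : ∀ b, Matrix (Idx m k) (Fin (size m k b)) ℝ)
    (U : ∀ b, UT (Fin (size m k b)))
    (hV : ∀ a b, b ≤ a → (inc m k a)ᵀ * V b = (inc m k a)ᵀ * (inc m k b * mat (U b))) :
    ∃ u : UT (Idx m k), ∀ b, mat u * inc m k b = V b := by
  have hentry (a b : Fin 9) (hba : b ≤ a) (r q) :
      V b (pos a r) q = (inc m k b * mat (U b)) (pos a r) q := by
    have h := hV a b hba
    rw [transpose_inc_mul, transpose_inc_mul] at h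
    exact congrFun (congrFun h r) q
  refine ⟨ofMat (fun p q => V (blkOf q) p (ofLex q).2) (fun ⟨b, r⟩ => ?_) ?_, fun b => ?_⟩
  · exact (hentry b b le_rfl r r).trans ((inc_mul_apply_self _ _ _).trans (mat_apply_self _ _))
  · rintro ⟨a, r⟩ ⟨b, q⟩ (hqp : pos b q < pos a r)
    refine (hentry a b (blkOf_mono hqp.le) r q).trans ?_
    rcases eq_or_ne a b with rfl | hab
    · exact (inc_mul_apply_self _ _ _).trans (isUpperTriangular_mat _ (pos_lt_pos.1 hqp))
    · exact inc_mul_apply_of_ne hab _ _ _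
  · exact mul_inc _ b

theorem exists_pivot_inverse {Y : Matrix (Idx m k) (Idx m k) ℝ} {s : Fin 3}
    (hs : (pivotBlk Y s).det ≠ 0) :
    ∃ Q : Matrix (Fin (size m k (colBlk s))) (Fin (size m k (rowBlk s))) ℝ,
      blk Y (rowBlk s) (colBlk s) * Q = 1 ∧ Q * blk Y (rowBlk s) (colBlk s) = 1 := by
  let c := finCongr (size_rowBlk m k s)
  have hunit : IsUnit (pivotBlk Y s).det := hs.isUnit
  have hblk : blk Y (rowBlk s) (colBlk s) = (pivotBlk Y s).submatrix id c.symm := rfl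
  refine ⟨(pivotBlk Y s)⁻¹.submatrix c.symm id, ?_, ?_⟩
  · rw [hblk, Matrix.submatrix_mul_equiv, Matrix.mul_nonsing_inv _ hunit, Matrix.submatrix_id_id]
  · rw [hblk, ← Matrix.submatrix_mul _ _ _ _ _ Function.bijective_id,
      Matrix.nonsing_inv_mul _ hunit, Matrix.submatrix_one_equiv]

namespace SatisfiesSystem

variable {γ₁ γ₂ : ℝ} {Y : Matrix (Idx m k) (Idx m k) ℝ} (hY : SatisfiesSystem γ₁ γ₂ Y)
include hY

theorem blk_eq_zero_of_le {a b : Fin 9} (hba : b ≤ a) : blk Y a b = 0 := by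
  rcases hba.lt_or_eq with hlt | rfl
  · exact blk_eq_zero_of_mem_ut hY.mem_ut hlt
  have hb : b ∈ ({0, 3, 5, 8} : Set (Fin 9)) ∨ b = 1 ∨ b = 2 ∨ b = 4 ∨ b = 6 ∨ b = 7 := by
    revert b; decide
  rcases hb with h | rfl | rfl | rfl | rfl | rfl
  · exact hY.blk_self_eq_zero _ h
  all_goals exact blk_self_eq_zero_of_mem_ut hY.mem_ut rfl

theorem blk_eq_sum_of_mem_bullets {i j : Fin 9} (hij : (i, j) ∈ bullets)
    (X : ∀ t, Matrix (Fin (size m k (colBlk t))) (Fin (size m k j)) ℝ)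
    (hX : ∀ s : PhiOf i j, ∑ t : PhiOf i j, blk Y (rowBlk s) (colBlk t) * X t =
      blk Y (rowBlk s) j) :
    blk Y i j = ∑ t : PhiOf i j, blk Y i (colBlk t) * X t := by
  have hsum (p : Idx m k) (q : Fin (size m k j)) :
      ∑ t : MinorIdx m k i j, Y p (minorCol t) * X t.1 (Fin.cast (size_rowBlk m k t.1) t.2) q =
        (∑ t : PhiOf i j, Y.submatrix (fun _ : Unit => p) (pos (colBlk t)) * X t) () q := by
    rw [Fintype.sum_sigma, Matrix.sum_apply]
    exact Finset.sum_congr rfl fun t _ => (finCongr (size_rowBlk m k t)).sum_comp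
      fun r => Y p (pos (colBlk t) r) * X t r q
  ext r q
  have hminor : borderedMinor Y i j r q = _ := det_submatrix_sumElim_of_column_relation
    (M := Y) (f := minorRow) (g := minorCol) (q := pos j q)
    (x := fun t => X t.1 (Fin.cast (size_rowBlk m k t.1) t.2) q)
    (fun s => by
      rw [hsum, Matrix.sum_apply]
      refine Eq.trans ?_ (congrFun (congrFun (hX s.1) s.2) q)
      rw [Matrix.sum_apply]
      rfl) (pos i r)
  rw [hY.borderedMinor_eq_zero i j hij, eq_comm, mul_eq_zero,
    or_iff_right (det_submatrix_minor_ne_zero hY.mem_ut hY.det_pivotBlk_ne_zero i j), sub_eq_zero,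
    hsum, Matrix.sum_apply] at hminor
  rw [Matrix.sum_apply]
  exact hminor

theorem blk_eq_zero_of_mem_bullets {i j : Fin 9} (hij : (i, j) ∈ bullets)
    (hempty : ∀ s : Fin 3, ¬(i < rowBlk s ∧ colBlk s < j)) : blk Y i j = 0 := by
  have : IsEmpty (PhiOf i j) := ⟨fun s => hempty s s.2⟩
  simpa using hY.blk_eq_sum_of_mem_bullets hij 0 fun s => isEmptyElim s

theorem blk_colBlk_eq_zero {a : Fin 9} {t : Fin 3} (ha : rowBlk t < a) :
    blk Y a (colBlk t) = 0 := by
  have hcases : ∀ (a : Fin 9) (t : Fin 3), rowBlk t < a → colBlk t ≤ a ∨ (a = 4 ∧ t = 1) := by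
    decide
  rcases hcases a t ha with h | ⟨rfl, rfl⟩
  · exact hY.blk_eq_zero_of_le h
  · exact hY.blk_eq_zero_of_mem_bullets (j := 5) (by decide) (by decide)

theorem sum_PhiOf_eq {i j a : Fin 9}
    {X : ∀ t, Matrix (Fin (size m k (colBlk t))) (Fin (size m k j)) ℝ}
    (hX : ∀ t, j ≤ colBlk t → X t = 0) (ha : ∀ t, rowBlk t ≤ i → rowBlk t < a) :
    ∑ t : PhiOf i j, blk Y a (colBlk t) * X t = ∑ t, blk Y a (colBlk t) * X t := by
  refine Fintype.sum_of_injective Subtype.val Subtype.val_injective _ _ (fun t ht => ?_)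
    fun _ => rfl
  have hPhi : ¬(i < rowBlk t ∧ colBlk t < j) := fun h => ht ⟨⟨t, h⟩, rfl⟩
  rcases not_and_or.1 hPhi with ht | ht <;> rw [not_lt] at ht
  · rw [hY.blk_colBlk_eq_zero (ha t ht), Matrix.zero_mul]
  · rw [hX t ht, Matrix.mul_zero]

theorem exists_pivot_solution {n : Type*}
    (B : ∀ s, Matrix (Fin (size m k (rowBlk s))) n ℝ) :
    ∃ X : ∀ t, Matrix (Fin (size m k (colBlk t))) n ℝ,
      (∀ s, ∑ t, blk Y (rowBlk s) (colBlk t) * X t = B s) ∧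
        ∀ t, (∀ s, t ≤ s → B s = 0) → X t = 0 := by
  choose Q hQ _ using fun s => exists_pivot_inverse (hY.det_pivotBlk_ne_zero s)
  let A (s t : Fin 3) := blk Y (rowBlk s) (colBlk t)
  have hA {s t : Fin 3} (hts : t < s) : A s t = 0 := hY.blk_colBlk_eq_zero <| by
    revert s t; decide
  let X₂ := Q 2 * B 2
  let X₁ := Q 1 * (B 1 - A 1 2 * X₂)
  let X₀ := Q 0 * (B 0 - A 0 1 * X₁ - A 0 2 * X₂)
  let X : ∀ t, Matrix (Fin (size m k (colBlk t))) n ℝ := fun | 0 => X₀ | 1 => X₁ | 2 => X₂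
  have hmul (s) (M : Matrix (Fin (size m k (rowBlk s))) n ℝ) : A s s * (Q s * M) = M := by
    rw [← Matrix.mul_assoc, hQ, Matrix.one_mul]
  have h₀ : A 0 0 * X₀ + A 0 1 * X₁ + A 0 2 * X₂ = B 0 := by rw [hmul]; abel
  have h₁ : A 1 0 * X₀ + A 1 1 * X₁ + A 1 2 * X₂ = B 1 := by
    rw [hmul, hA (by decide), Matrix.zero_mul]; abel
  have h₂ : A 2 0 * X₀ + A 2 1 * X₁ + A 2 2 * X₂ = B 2 := by
    rw [hmul, hA (by decide), hA (by decide), Matrix.zero_mul, Matrix.zero_mul]; abel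
  have hQ_zero {s} {M : Matrix (Fin (size m k (rowBlk s))) n ℝ} (hM : M = 0) : Q s * M = 0 := by
    rw [hM, Matrix.mul_zero]
  have hX₂ (hB₂ : B 2 = 0) : X₂ = 0 := hQ_zero hB₂
  have hX₁ (hB₁ : B 1 = 0) (hB₂ : B 2 = 0) : X₁ = 0 := hQ_zero <| by
    rw [hB₁, hX₂ hB₂, Matrix.mul_zero, sub_zero]
  have hX₀ (hB₀ : B 0 = 0) (hB₁ : B 1 = 0) (hB₂ : B 2 = 0) : X₀ = 0 := hQ_zero <| by
    rw [hB₀, hX₁ hB₁ hB₂, hX₂ hB₂, Matrix.mul_zero, Matrix.mul_zero, sub_zero, sub_zero]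
  refine ⟨X, fun s => (Fin.sum_univ_three _).trans ?_, fun t ht => ?_⟩
  · match s with
    | 0 => exact h₀
    | 1 => exact h₁
    | 2 => exact h₂
  · match t with
    | 0 => exact hX₀ (ht 0 le_rfl) (ht 1 (by decide)) (ht 2 (by decide))
    | 1 => exact hX₁ (ht 1 le_rfl) (ht 2 (by decide))
    | 2 => exact hX₂ (ht 2 le_rfl)

theorem blk_eq_sum_colBlk {i j : Fin 9} (hj : j ∈ ({3, 4, 6, 8} : Set (Fin 9)))
    (hij : (i, j) ≠ (0, 8)) {X : ∀ t, Matrix (Fin (size m k (colBlk t))) (Fin (size m k j)) ℝ}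
    (hrow : ∀ s, ∑ t, blk Y (rowBlk s) (colBlk t) * X t = blk Y (rowBlk s) j)
    (hX : ∀ t, j ≤ colBlk t → X t = 0) :
    blk Y i j = ∑ t, blk Y i (colBlk t) * X t := by
  have hcases : (∃ s, rowBlk s = i) ∨ ((i, j) ∈ bullets ∧ ∀ t, rowBlk t ≠ i) ∨
      (j ≤ i ∧ ∀ t, colBlk t < j → rowBlk t < i) := by
    clear hrow hX X
    revert i j; decide
  rcases hcases with ⟨s, rfl⟩ | ⟨hbullet, hi⟩ | ⟨hji, hcol⟩
  · exact (hrow s).symm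
  · rw [hY.blk_eq_sum_of_mem_bullets hbullet X fun s => ?_,
      hY.sum_PhiOf_eq hX fun t ht => ht.lt_of_ne (hi t)]
    rw [hY.sum_PhiOf_eq hX fun t ht => ht.trans_lt s.2.1, hrow]
  · rw [hY.blk_eq_zero_of_le hji, eq_comm]
    refine Finset.sum_eq_zero fun t _ => ?_
    rcases lt_or_ge (colBlk t) j with ht | ht
    · rw [hY.blk_colBlk_eq_zero (hcol t ht), Matrix.zero_mul]
    · rw [hX t ht, Matrix.mul_zero]

theorem exists_mul_inc_eq {j : Fin 9} (hj : j ∈ ({3, 4, 6, 8} : Set (Fin 9))) :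
    ∃ (X : ∀ t, Matrix (Fin (size m k (colBlk t))) (Fin (size m k j)) ℝ)
      (T : Matrix (Fin (size m k 0)) (Fin (size m k j)) ℝ),
      (∀ t, j ≤ colBlk t → X t = 0) ∧ (j ≠ 8 → T = 0) ∧
        Y * inc m k j = ∑ t, Y * inc m k (colBlk t) * X t + inc m k 0 * T := by
  obtain ⟨X, hrow, hzero⟩ := hY.exists_pivot_solution fun s => blk Y (rowBlk s) j
  have hX (t) (ht : j ≤ colBlk t) : X t = 0 := hzero t fun s hts => by
    have hcases : j ≤ rowBlk s ∨ rowBlk s = 3 ∧ j = 4 := by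
      clear hrow hzero X
      revert j s t; decide
    rcases hcases with h | ⟨h, rfl⟩
    · exact hY.blk_eq_zero_of_le h
    · exact h ▸ hY.blk_eq_zero_of_mem_bullets (i := 3) (by decide) (by decide)
  have hblk (i : Fin 9) (hij : (i, j) ≠ (0, 8)) := hY.blk_eq_sum_colBlk hj hij hrow hX
  refine ⟨X, blk Y 0 j - ∑ t, blk Y 0 (colBlk t) * X t, hX, fun h8 => ?_, ?_⟩
  · exact sub_eq_zero.2 (hblk 0 fun h => h8 (congrArg Prod.snd h))
  have hsum : ∑ t, Y * inc m k (colBlk t) * X t =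
      ∑ a, inc m k a * ∑ t, blk Y a (colBlk t) * X t := by
    simp only [mul_inc_eq_sum, Matrix.sum_mul, Matrix.mul_sum, Matrix.mul_assoc]
    exact Finset.sum_comm
  have htail (a : Fin 8) : blk Y a.succ j = ∑ t, blk Y a.succ (colBlk t) * X t :=
    hblk _ fun h => Fin.succ_ne_zero a (congrArg Prod.fst h)
  rw [hsum, mul_inc_eq_sum, Fin.sum_univ_succ, Fin.sum_univ_succ (n := 8), Matrix.mul_sub]
  simp only [htail]
  abel

end SatisfiesSystem

end Columns

/-! ### The normal form of a solution -/

section NormalFormColumns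

variable {m k : ℕ} (p : Matrix (Fin (size m k 1)) (Fin (size m k 2)) ℝ)
  (w : Matrix (Fin (size m k 6)) (Fin (size m k 7)) ℝ)
  (s : Matrix (Fin (size m k 1)) (Fin (size m k 6)) ℝ)
  (A : Matrix (Fin (size m k 3)) (Fin (size m k 5)) ℝ)
  (T : Matrix (Fin (size m k 0)) (Fin (size m k 8)) ℝ)

theorem normalForm_mul_inc_eq_zero {b : Fin 9} (hb : b ∈ ({0, 1, 3, 4} : Set (Fin 9))) :
    normalForm p w s A T * inc m k b = 0 := by
  rcases hb with rfl | rfl | rfl | rfl <;>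
    simp (disch := decide) only [normalForm, Matrix.add_mul, inBlock_mul_inc_of_ne, add_zero]

theorem normalForm_mul_inc_two : normalForm p w s A T * inc m k 2 = inc m k 1 * p := by
  simp (disch := decide) only [normalForm, Matrix.add_mul, inBlock_mul_inc_self,
    inBlock_mul_inc_of_ne, add_zero]

theorem normalForm_mul_inc_five : normalForm p w s A T * inc m k 5 = inc m k 3 * A := by
  simp (disch := decide) only [normalForm, Matrix.add_mul, inBlock_mul_inc_self,
    inBlock_mul_inc_of_ne, add_zero, zero_add]

theorem normalForm_mul_inc_six : normalForm p w s A T * inc m k 6 = inc m k 1 * s := by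
  simp (disch := decide) only [normalForm, Matrix.add_mul, inBlock_mul_inc_self,
    inBlock_mul_inc_of_ne, add_zero, zero_add]

theorem normalForm_mul_inc_seven : normalForm p w s A T * inc m k 7 = inc m k 6 * w := by
  simp (disch := decide) only [normalForm, Matrix.add_mul, inBlock_mul_inc_self,
    inBlock_mul_inc_of_ne, add_zero, zero_add]

theorem normalForm_mul_inc_eight : normalForm p w s A T * inc m k 8 = inc m k 0 * T := by
  simp (disch := decide) only [normalForm, Matrix.add_mul, inBlock_mul_inc_self,
    inBlock_mul_inc_of_ne, zero_add]

variable {p w s A T}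

theorem mul_eq_mul_normalForm {Y M : Matrix (Idx m k) (Idx m k) ℝ}
    (hzero : ∀ b ∈ ({0, 1, 3, 4} : Set (Fin 9)), Y * (M * inc m k b) = 0)
    (h₂ : Y * (M * inc m k 2) = M * inc m k 1 * p) (h₅ : Y * (M * inc m k 5) = M * inc m k 3 * A)
    (h₆ : Y * (M * inc m k 6) = M * inc m k 1 * s) (h₇ : Y * (M * inc m k 7) = M * inc m k 6 * w)
    (h₈ : Y * (M * inc m k 8) = M * inc m k 0 * T) : Y * M = M * normalForm p w s A T := by
  refine ext_of_mul_inc fun b => ?_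
  rw [Matrix.mul_assoc, Matrix.mul_assoc]
  have hb : b ∈ ({0, 1, 3, 4} : Set (Fin 9)) ∨ b = 2 ∨ b = 5 ∨ b = 6 ∨ b = 7 ∨ b = 8 := by
    revert b; decide
  rcases hb with hb | rfl | rfl | rfl | rfl | rfl
  · rw [hzero b hb, normalForm_mul_inc_eq_zero p w s A T hb, Matrix.mul_zero]
  · rw [h₂, normalForm_mul_inc_two, Matrix.mul_assoc]
  · rw [h₅, normalForm_mul_inc_five, Matrix.mul_assoc]
  · rw [h₆, normalForm_mul_inc_six, Matrix.mul_assoc]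
  · rw [h₇, normalForm_mul_inc_seven, Matrix.mul_assoc]
  · rw [h₈, normalForm_mul_inc_eight, Matrix.mul_assoc]

end NormalFormColumns

section Reduction

variable {m k : ℕ}

namespace SatisfiesSystem

variable {γ₁ γ₂ : ℝ} {Y : Matrix (Idx m k) (Idx m k) ℝ} (hY : SatisfiesSystem γ₁ γ₂ Y)
include hY

theorem eq_zero_of_blk_mul_eq_zero (s : Fin 3) {n : Type*}
    {M : Matrix (Fin (size m k (colBlk s))) n ℝ} (hM : blk Y (rowBlk s) (colBlk s) * M = 0) :
    M = 0 := by
  obtain ⟨Q, -, hQ⟩ := exists_pivot_inverse (hY.det_pivotBlk_ne_zero s)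
  rw [← Matrix.one_mul M, ← hQ, Matrix.mul_assoc, hM, Matrix.mul_zero]

theorem mul_inc_zero : Y * inc m k 0 = 0 := by
  rw [mul_inc_eq_sum]
  refine Finset.sum_eq_zero fun a _ => ?_
  rw [hY.blk_eq_zero_of_le (Fin.zero_le a), Matrix.mul_zero]

theorem mul_inc_one : Y * inc m k 1 = 0 := by
  rw [mul_inc_eq_sum]
  refine Finset.sum_eq_zero fun a _ => ?_
  have ha : (a, 1) ∈ bullets ∨ 1 ≤ a := by revert a; decide
  rcases ha with ha | ha
  · rw [hY.blk_eq_zero_of_mem_bullets ha (by decide +revert), Matrix.mul_zero]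
  · rw [hY.blk_eq_zero_of_le ha, Matrix.mul_zero]

theorem mul_mul_inc_eq_sum (b : Fin 9) :
    Y * (Y * inc m k b) = ∑ a ∈ Finset.Ioo 1 b, Y * inc m k a * blk Y a b := by
  rw [mul_inc_eq_sum Y b, Matrix.mul_sum]
  simp only [← Matrix.mul_assoc]
  refine (Finset.sum_subset (Finset.subset_univ _) fun a _ ha => ?_).symm
  have ha : a = 0 ∨ a = 1 ∨ b ≤ a := by revert a b; decide
  rcases ha with rfl | rfl | ha
  · rw [hY.mul_inc_zero, Matrix.zero_mul]
  · rw [hY.mul_inc_one, Matrix.zero_mul]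
  · rw [hY.blk_eq_zero_of_le ha, Matrix.mul_zero]

theorem mul_mul_inc_two : Y * (Y * inc m k 2) = 0 := by
  rw [hY.mul_mul_inc_eq_sum, (by decide : Finset.Ioo (1 : Fin 9) 2 = ∅), Finset.sum_empty]

theorem exists_mul_inc_eq_two_mul {j : Fin 9} (hj : j = 3 ∨ j = 4) :
    ∃ X : Matrix (Fin (size m k 2)) (Fin (size m k j)) ℝ, Y * inc m k j = Y * inc m k 2 * X := by
  have hj5 : j < 5 := by decide +revert
  obtain ⟨X, T, hX, hT, h⟩ := hY.exists_mul_inc_eq (j := j) (by decide +revert)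
  refine ⟨X 0, ?_⟩
  rw [h, hT (hj5.trans (by decide)).ne, Fin.sum_univ_three, hX 1 hj5.le,
    hX 2 (hj5.le.trans (by decide))]
  simp only [Matrix.mul_zero, add_zero]
  rfl

theorem exists_mul_inc_six_eq :
    ∃ (X : Matrix (Fin (size m k 2)) (Fin (size m k 6)) ℝ)
      (Z : Matrix (Fin (size m k 5)) (Fin (size m k 6)) ℝ),
      Y * inc m k 6 = Y * inc m k 2 * X + Y * inc m k 5 * Z := by
  obtain ⟨X, T, hX, hT, h⟩ := hY.exists_mul_inc_eq (j := 6) (by decide)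
  refine ⟨X 0, X 1, ?_⟩
  rw [h, hT (by decide), Fin.sum_univ_three, hX 2 (by decide)]
  simp only [Matrix.mul_zero, add_zero]
  rfl

theorem exists_mul_inc_eight_eq :
    ∃ (X : Matrix (Fin (size m k 2)) (Fin (size m k 8)) ℝ)
      (Z : Matrix (Fin (size m k 5)) (Fin (size m k 8)) ℝ)
      (W : Matrix (Fin (size m k 7)) (Fin (size m k 8)) ℝ)
      (T : Matrix (Fin (size m k 0)) (Fin (size m k 8)) ℝ),
      Y * inc m k 8 = Y * inc m k 2 * X + Y * inc m k 5 * Z + Y * inc m k 7 * W +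
        inc m k 0 * T := by
  obtain ⟨X, T, -, -, h⟩ := hY.exists_mul_inc_eq (j := 8) (by decide)
  exact ⟨X 0, X 1, X 2, T, by rw [h, Fin.sum_univ_three]; rfl⟩

theorem mul_mul_inc_five : Y * (Y * inc m k 5) = 0 := by
  obtain ⟨X, hX⟩ := hY.exists_mul_inc_eq_two_mul (j := 3) (by decide)
  have h₁₃ : blk Y 1 3 = blk Y 1 2 * X := by
    rw [← transpose_inc_mul_mul_inc, ← transpose_inc_mul_mul_inc, Matrix.mul_assoc, hX]
    simp only [Matrix.mul_assoc]
  have hzero : blk Y 2 5 + X * blk Y 3 5 = 0 := hY.eq_zero_of_blk_mul_eq_zero 0 <| by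
    change blk Y 1 2 * (blk Y 2 5 + X * blk Y 3 5) = 0
    rw [Matrix.mul_add, ← Matrix.mul_assoc, ← h₁₃, hY.blk_one_two_mul_add]
  calc Y * (Y * inc m k 5)
      = Y * inc m k 2 * blk Y 2 5 + Y * inc m k 3 * blk Y 3 5 + Y * inc m k 4 * blk Y 4 5 := by
        rw [hY.mul_mul_inc_eq_sum, (by decide : Finset.Ioo (1 : Fin 9) 5 = {2, 3, 4})]
        simp [add_assoc]
    _ = Y * inc m k 2 * (blk Y 2 5 + X * blk Y 3 5) := by
        rw [hY.blk_eq_zero_of_mem_bullets (i := 4) (by decide) (by decide), hX, Matrix.mul_zero,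
          add_zero, Matrix.mul_add, Matrix.mul_assoc _ X]
    _ = 0 := by rw [hzero, Matrix.mul_zero]

theorem exists_mul_mul_inc_seven_eq :
    ∃ R : Matrix (Fin (size m k 2)) (Fin (size m k 7)) ℝ,
      Y * (Y * inc m k 7) = Y * inc m k 2 * R := by
  obtain ⟨X₃, hX₃⟩ := hY.exists_mul_inc_eq_two_mul (j := 3) (by decide)
  obtain ⟨X₄, hX₄⟩ := hY.exists_mul_inc_eq_two_mul (j := 4) (by decide)
  obtain ⟨X₆, Z, hX₆⟩ := hY.exists_mul_inc_six_eq
  have h₃₆ : blk Y 3 6 = blk Y 3 5 * Z := by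
    have h₃₂ : (inc m k 3)ᵀ * Y * inc m k 2 = 0 := by
      rw [transpose_inc_mul_mul_inc, hY.blk_eq_zero_of_le (by decide)]
    rw [← transpose_inc_mul_mul_inc, ← transpose_inc_mul_mul_inc, Matrix.mul_assoc, hX₆,
      Matrix.mul_add]
    simp only [← Matrix.mul_assoc]
    rw [h₃₂, Matrix.zero_mul, zero_add]
  have hzero : blk Y 5 7 + Z * blk Y 6 7 = 0 := hY.eq_zero_of_blk_mul_eq_zero 1 <| by
    change blk Y 3 5 * (blk Y 5 7 + Z * blk Y 6 7) = 0
    rw [Matrix.mul_add, ← Matrix.mul_assoc, ← h₃₆, hY.blk_three_five_mul_add]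
  refine ⟨blk Y 2 7 + X₃ * blk Y 3 7 + X₄ * blk Y 4 7 + X₆ * blk Y 6 7, ?_⟩
  calc Y * (Y * inc m k 7)
      = Y * inc m k 2 * blk Y 2 7 + Y * inc m k 3 * blk Y 3 7 + Y * inc m k 4 * blk Y 4 7 +
          Y * inc m k 5 * blk Y 5 7 + Y * inc m k 6 * blk Y 6 7 := by
        rw [hY.mul_mul_inc_eq_sum, (by decide : Finset.Ioo (1 : Fin 9) 7 = {2, 3, 4, 5, 6})]
        simp [add_assoc]
    _ = Y * inc m k 2 * (blk Y 2 7 + X₃ * blk Y 3 7 + X₄ * blk Y 4 7 + X₆ * blk Y 6 7) +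
          Y * inc m k 5 * (blk Y 5 7 + Z * blk Y 6 7) := by
        rw [hX₃, hX₄, hX₆]
        simp only [Matrix.mul_add, Matrix.add_mul, Matrix.mul_assoc]
        abel
    _ = _ := by rw [hzero, Matrix.mul_zero, add_zero]

theorem transpose_inc_mul_mul_inc_colBlk_mul {s : Fin 3}
    {Q : Matrix (Fin (size m k (colBlk s))) (Fin (size m k (rowBlk s))) ℝ}
    (hQ : blk Y (rowBlk s) (colBlk s) * Q = 1) {a : Fin 9} (ha : rowBlk s ≤ a) :
    (inc m k a)ᵀ * (Y * inc m k (colBlk s) * Q) = (inc m k a)ᵀ * inc m k (rowBlk s) := by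
  rw [← Matrix.mul_assoc, ← Matrix.mul_assoc, transpose_inc_mul_mul_inc]
  rcases ha.lt_or_eq with hlt | rfl
  · rw [hY.blk_colBlk_eq_zero hlt, transpose_inc_mul_inc_of_ne hlt.ne', Matrix.zero_mul]
  · rw [hQ, transpose_inc_mul_inc_self]

end SatisfiesSystem

section ChainBasis

variable (Y : Matrix (Idx m k) (Idx m k) ℝ)
  (P : Matrix (Fin (size m k 2)) (Fin (size m k 1)) ℝ)
  (Q : Matrix (Fin (size m k 5)) (Fin (size m k 3)) ℝ)
  (R : Matrix (Fin (size m k 7)) (Fin (size m k 6)) ℝ)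
  (X₄ : Matrix (Fin (size m k 2)) (Fin (size m k 4)) ℝ)
  (X₂ : Matrix (Fin (size m k 2)) (Fin (size m k 8)) ℝ)
  (X₅ : Matrix (Fin (size m k 5)) (Fin (size m k 8)) ℝ)
  (X₇ : Matrix (Fin (size m k 7)) (Fin (size m k 8)) ℝ)

/-- The columns, grouped in blocks, of a basis in which a solution `Y` of the system takes its
normal form: the columns `2`, `5`, `7` of `Y`, normalized by the inverses `P`, `Q`, `R` of the
pivots, replace the blocks `1`, `3`, `6` of the standard basis, and the blocks `4` and `8` are
corrected by the coefficients of the linear relations between the columns of `Y`. -/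
def chainBasis : ∀ b, Matrix (Idx m k) (Fin (size m k b)) ℝ
  | 0 => inc m k 0
  | 1 => Y * inc m k 2 * P
  | 2 => inc m k 2
  | 3 => Y * inc m k 5 * Q
  | 4 => inc m k 4 - inc m k 2 * X₄
  | 5 => inc m k 5
  | 6 => Y * inc m k 7 * R
  | 7 => inc m k 7
  | 8 => inc m k 8 - (inc m k 2 * X₂ + inc m k 5 * X₅ + inc m k 7 * X₇)

variable {Y P Q R X₄ X₂ X₅ X₇}

theorem transpose_inc_mul_inc_mul_eq_zero {a b : Fin 9} (h : b < a) {n : Type*}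
    (M : Matrix (Fin (size m k b)) n ℝ) : (inc m k a)ᵀ * (inc m k b * M) = 0 := by
  rw [← Matrix.mul_assoc, transpose_inc_mul_inc_of_ne h.ne', Matrix.zero_mul]

variable {γ₁ γ₂ : ℝ} in
theorem SatisfiesSystem.transpose_inc_mul_chainBasis (hY : SatisfiesSystem γ₁ γ₂ Y)
    (hP : blk Y 1 2 * P = (1 : Matrix (Fin (size m k 1)) (Fin (size m k 1)) ℝ))
    (hQ : blk Y 3 5 * Q = (1 : Matrix (Fin (size m k 3)) (Fin (size m k 3)) ℝ))
    (hR : blk Y 6 7 * R = (1 : Matrix (Fin (size m k 6)) (Fin (size m k 6)) ℝ))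
    (a b : Fin 9) (hba : b ≤ a) :
    (inc m k a)ᵀ * chainBasis Y P Q R X₄ X₂ X₅ X₇ b = (inc m k a)ᵀ * inc m k b := by
  have hlt {c d : Fin 9} (hcd : c < d) (hda : d ≤ a) := hcd.trans_le hda
  match b with
  | 0 => rfl
  | 1 => exact hY.transpose_inc_mul_mul_inc_colBlk_mul (s := 0) hP hba
  | 2 => rfl
  | 3 => exact hY.transpose_inc_mul_mul_inc_colBlk_mul (s := 1) hQ hba
  | 4 =>
    change _ * (inc m k 4 - inc m k 2 * X₄) = _
    rw [Matrix.mul_sub, transpose_inc_mul_inc_mul_eq_zero (hlt (by decide) hba), sub_zero]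
  | 5 => rfl
  | 6 => exact hY.transpose_inc_mul_mul_inc_colBlk_mul (s := 2) hR hba
  | 7 => rfl
  | 8 =>
    change _ * (inc m k 8 - (inc m k 2 * X₂ + inc m k 5 * X₅ + inc m k 7 * X₇)) = _
    rw [Matrix.mul_sub, Matrix.mul_add, Matrix.mul_add,
      transpose_inc_mul_inc_mul_eq_zero (hlt (by decide) hba),
      transpose_inc_mul_inc_mul_eq_zero (hlt (by decide) hba),
      transpose_inc_mul_inc_mul_eq_zero (hlt (by decide) hba), add_zero, add_zero, sub_zero]

end ChainBasis

theorem SatisfiesSystem.exists_normalForm {γ₁ γ₂ : ℝ} {Y : Matrix (Idx m k) (Idx m k) ℝ}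
    (hY : SatisfiesSystem γ₁ γ₂ Y) :
    ∃ (u : UT (Idx m k)) (p : Matrix (Fin (size m k 1)) (Fin (size m k 2)) ℝ)
      (w : Matrix (Fin (size m k 6)) (Fin (size m k 7)) ℝ)
      (s : Matrix (Fin (size m k 1)) (Fin (size m k 6)) ℝ)
      (A : Matrix (Fin (size m k 3)) (Fin (size m k 5)) ℝ)
      (T : Matrix (Fin (size m k 0)) (Fin (size m k 8)) ℝ),
      γ₁ * p (0 : Fin 1) (0 : Fin 1) = γ₂ * w (0 : Fin 1) (0 : Fin 1) ∧
        Y * mat u = mat u * normalForm p w s A T := by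
  obtain ⟨P, hP, hP'⟩ : ∃ P : Matrix (Fin (size m k 2)) (Fin (size m k 1)) ℝ,
      blk Y 1 2 * P = (1 : Matrix (Fin (size m k 1)) (Fin (size m k 1)) ℝ) ∧
        P * blk Y 1 2 = (1 : Matrix (Fin (size m k 2)) (Fin (size m k 2)) ℝ) :=
    exists_pivot_inverse (hY.det_pivotBlk_ne_zero 0)
  obtain ⟨Q, hQ, hQ'⟩ : ∃ Q : Matrix (Fin (size m k 5)) (Fin (size m k 3)) ℝ,
      blk Y 3 5 * Q = (1 : Matrix (Fin (size m k 3)) (Fin (size m k 3)) ℝ) ∧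
        Q * blk Y 3 5 = (1 : Matrix (Fin (size m k 5)) (Fin (size m k 5)) ℝ) :=
    exists_pivot_inverse (hY.det_pivotBlk_ne_zero 1)
  obtain ⟨R, hR, hR'⟩ : ∃ R : Matrix (Fin (size m k 7)) (Fin (size m k 6)) ℝ,
      blk Y 6 7 * R = (1 : Matrix (Fin (size m k 6)) (Fin (size m k 6)) ℝ) ∧
        R * blk Y 6 7 = (1 : Matrix (Fin (size m k 7)) (Fin (size m k 7)) ℝ) :=
    exists_pivot_inverse (hY.det_pivotBlk_ne_zero 2)
  obtain ⟨X₄, hX₄⟩ := hY.exists_mul_inc_eq_two_mul (j := 4) (by decide)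
  obtain ⟨X₂, X₅, X₇, T, hX⟩ := hY.exists_mul_inc_eight_eq
  obtain ⟨W, hW⟩ := hY.exists_mul_mul_inc_seven_eq
  obtain ⟨u, hu⟩ := exists_mat_mul_inc_eq (chainBasis Y P Q R X₄ X₂ X₅ X₇) (fun _ => 1)
    fun a b hba => by rw [mat_one, Matrix.mul_one, hY.transpose_inc_mul_chainBasis hP hQ hR a b hba]
  refine ⟨u, blk Y 1 2, blk Y 6 7, blk Y 1 2 * W * R, blk Y 3 5, T, hY.relation,
    mul_eq_mul_normalForm ?_ ?_ ?_ ?_ ?_ ?_⟩ <;> simp only [hu, chainBasis]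
  · rintro b (rfl | rfl | rfl | rfl)
    · exact hY.mul_inc_zero
    · change Y * (Y * inc m k 2 * P) = 0
      rw [← Matrix.mul_assoc, hY.mul_mul_inc_two, Matrix.zero_mul]
    · change Y * (Y * inc m k 5 * Q) = 0
      rw [← Matrix.mul_assoc, hY.mul_mul_inc_five, Matrix.zero_mul]
    · change Y * (inc m k 4 - inc m k 2 * X₄) = 0
      rw [Matrix.mul_sub, hX₄, Matrix.mul_assoc, sub_self]
  · rw [Matrix.mul_assoc, hP', Matrix.mul_one]
  · rw [Matrix.mul_assoc, hQ', Matrix.mul_one]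
  · rw [← Matrix.mul_assoc, hW, Matrix.mul_assoc _ P, ← Matrix.mul_assoc P, ← Matrix.mul_assoc P,
      hP', Matrix.one_mul, Matrix.mul_assoc]
  · rw [Matrix.mul_assoc, hR', Matrix.mul_one]
  · rw [Matrix.mul_sub, Matrix.mul_add, Matrix.mul_add, hX]
    simp only [Matrix.mul_assoc]
    abel

end Reduction

/-! ### Approximation by conjugates of elements of the stabilizer -/

section Approximation

variable {m k : ℕ} (p : Matrix (Fin (size m k 1)) (Fin (size m k 2)) ℝ)
  (w : Matrix (Fin (size m k 6)) (Fin (size m k 7)) ℝ)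
  (s : Matrix (Fin (size m k 1)) (Fin (size m k 6)) ℝ)

theorem normalForm_mem_ut (A : Matrix (Fin (size m k 3)) (Fin (size m k 5)) ℝ)
    (T : Matrix (Fin (size m k 0)) (Fin (size m k 8)) ℝ) : normalForm p w s A T ∈ ut (Idx m k) :=
  mem_ut_of_blk fun a b hba => blk_normalForm_eq_zero p w s A T (by revert a b; decide)

theorem exists_normalForm_mul_mat_eq {A D : Matrix (Fin (size m k 3)) (Fin (size m k 5)) ℝ}
    {T E : Matrix (Fin (size m k 0)) (Fin (size m k 8)) ℝ}
    {u₀ : UT (Fin (size m k 0))} {u₃ : UT (Fin (size m k 3))} {u₅ : UT (Fin (size m k 5))}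
    {u₈ : UT (Fin (size m k 8))} (hA : A * mat u₅ = mat u₃ * D) (hT : T * mat u₈ = mat u₀ * E) :
    ∃ u : UT (Idx m k), normalForm p w s A T * mat u = mat u * normalForm p w s D E := by
  let U : ∀ b, UT (Fin (size m k b))
    | 0 => u₀
    | 3 => u₃
    | 5 => u₅
    | 8 => u₈
    | 1 | 2 | 4 | 6 | 7 => 1
  obtain ⟨u, hu⟩ := exists_mat_mul_inc_eq (fun b => inc m k b * mat (U b)) U fun _ _ _ => rfl
  have hu_one {b : Fin 9} (hb : U b = 1) : mat u * inc m k b = inc m k b := by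
    rw [hu, hb, mat_one, Matrix.mul_one]
  refine ⟨u, mul_eq_mul_normalForm ?_ ?_ ?_ ?_ ?_ ?_⟩
  · intro b hb
    rw [hu, ← Matrix.mul_assoc, normalForm_mul_inc_eq_zero p w s A T hb, Matrix.zero_mul]
  · rw [hu_one rfl, hu_one rfl, normalForm_mul_inc_two]
  · rw [hu, hu, ← Matrix.mul_assoc, normalForm_mul_inc_five, Matrix.mul_assoc, Matrix.mul_assoc]
    exact congrArg (inc m k 3 * ·) hA
  · rw [hu_one rfl, hu_one rfl, normalForm_mul_inc_six]
  · rw [hu_one rfl, hu_one rfl, normalForm_mul_inc_seven]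
  · rw [hu, hu, ← Matrix.mul_assoc, normalForm_mul_inc_eight, Matrix.mul_assoc, Matrix.mul_assoc]
    exact congrArg (inc m k 0 * ·) hT

variable {p w} {l₁ : Fin m → ℝ} {l₂ : Fin k → ℝ} {γ₁ γ₂ : ℝ} (hl₁ : ∀ r, l₁ r ≠ 0)
  (hl₂ : ∀ r, l₂ r ≠ 0) (hγ₁ : γ₁ ≠ 0) (hγ₂ : γ₂ ≠ 0) (γ₃ : ℝ)
include hl₁ hl₂ hγ₁ hγ₂

theorem mem_conjSaturation_of_mul_eq_mul_normalForm
    (hpw : γ₁ * p (0 : Fin 1) (0 : Fin 1) = γ₂ * w (0 : Fin 1) (0 : Fin 1))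
    {A : Matrix (Fin (size m k 3)) (Fin (size m k 5)) ℝ}
    {T : Matrix (Fin (size m k 0)) (Fin (size m k 8)) ℝ} (hA : A ∈ bigCell k) (hT : T ∈ bigCell m)
    {g h : UT (Idx m k)} (hgh : (mat g - 1) * mat h = mat h * normalForm p w s A T) :
    g ∈ conjSaturation (coadStabilizer (fMat l₁ l₂ γ₁ γ₂ γ₃)) := by
  obtain ⟨u₃, u₅, D, hD, hAD⟩ := hA
  obtain ⟨u₀, u₈, E, hE, hTE⟩ := hT
  obtain ⟨u, hu⟩ := exists_normalForm_mul_mat_eq p w s hAD hTE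
  let x : UT (Idx m k) := oneAdd ⟨normalForm p w s D E, normalForm_mem_ut p w s D E⟩
  have hx : mat x - 1 = normalForm p w s D E := mat_oneAdd_sub_one _
  refine ⟨h * u, x, ?_, eq_conj_of_mat_sub_one_mul ?_⟩
  · rw [mem_coadStabilizer_iff, mem_coadStabAlgebra_fMat_iff hl₁ hl₂ hγ₁ hγ₂]
    exact hx ▸ hasStabShape_normalForm s hD hE hpw
  · calc (mat g - 1) * mat (h * u) = (mat g - 1) * mat h * mat u := by rw [mat_mul, mul_assoc]
      _ = mat (h * u) * normalForm p w s D E := by rw [hgh, mul_assoc, hu, mat_mul, mul_assoc]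
      _ = mat (h * u) * (mat x - 1) := congrArg (mat (h * u) * ·) hx.symm

theorem conj_oneAdd_normalForm_mem_closure
    (hpw : γ₁ * p (0 : Fin 1) (0 : Fin 1) = γ₂ * w (0 : Fin 1) (0 : Fin 1))
    (A : Matrix (Fin (size m k 3)) (Fin (size m k 5)) ℝ)
    (T : Matrix (Fin (size m k 0)) (Fin (size m k 8)) ℝ) (h : UT (Idx m k)) :
    h * oneAdd ⟨normalForm p w s A T, normalForm_mem_ut p w s A T⟩ * h⁻¹ ∈
      closure (conjSaturation (coadStabilizer (fMat l₁ l₂ γ₁ γ₂ γ₃))) := by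
  let F (B : Matrix (Fin k) (Fin k) ℝ × Matrix (Fin m) (Fin m) ℝ) : UT (Idx m k) :=
    h * oneAdd ⟨normalForm p w s B.1 B.2, normalForm_mem_ut p w s B.1 B.2⟩ * h⁻¹
  have hF : Continuous F := by
    refine (continuous_const.mul (continuous_oneAdd.comp (Continuous.subtype_mk ?_ _))).mul
      continuous_const
    unfold normalForm inBlock
    fun_prop
  change F (A, T) ∈ _
  refine map_mem_closure hF (((dense_bigCell k).prod (dense_bigCell m)) (A, T)) fun B hB => ?_
  refine mem_conjSaturation_of_mul_eq_mul_normalForm s hl₁ hl₂ hγ₁ hγ₂ γ₃ hpw hB.1 hB.2 (h := h) ?_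
  have hconj : mat (F B) - 1 = mat h * normalForm p w s B.1 B.2 * mat h⁻¹ :=
    (mat_conj_sub_one h _).trans (congrArg (mat h * · * mat h⁻¹) (mat_oneAdd_sub_one _))
  rw [hconj, mul_assoc, mat_inv_mul_mat]
  exact mul_one _

theorem mem_closure_conjSaturation {g : UT (Idx m k)}
    (hg : g ∈ zeroSet (d₁ m k) (I' m k γ₁ γ₂)) :
    g ∈ closure (conjSaturation (coadStabilizer (fMat l₁ l₂ γ₁ γ₂ γ₃))) := by
  obtain ⟨u, p, w, s, A, T, hpw, hu⟩ := (mem_zeroSet_iff.1 hg).exists_normalForm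
  rw [eq_conj_of_mat_sub_one_mul (hu.trans (congrArg (mat u * ·) (mat_oneAdd_sub_one
    ⟨_, normalForm_mem_ut p w s A T⟩).symm))]
  exact conj_oneAdd_normalForm_mem_closure s hl₁ hl₂ hγ₁ hγ₂ γ₃ hpw A T u

end Approximation

end Subregular

end

theorem proposition8 (m k : ℕ) (l₁ : Fin m → ℝ) (l₂ : Fin k → ℝ) (γ₁ γ₂ γ₃ : ℝ)
    (hl₁ : ∀ r, l₁ r ≠ 0) (hl₂ : ∀ r, l₂ r ≠ 0) (hγ₁ : γ₁ ≠ 0) (hγ₂ : γ₂ ≠ 0) :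
    closure (Subregular.zeroSet (Subregular.d₁ m k) (Subregular.I' m k γ₁ γ₂)) =
      closure (Subregular.conjSaturation
        (Subregular.coadStabilizer (Subregular.fMat l₁ l₂ γ₁ γ₂ γ₃))) := by
  refine Set.Subset.antisymm (closure_minimal ?_ isClosed_closure)
    (closure_minimal ?_ isClosed_closure)
  · intro g hg
    exact Subregular.mem_closure_conjSaturation hl₁ hl₂ hγ₁ hγ₂ γ₃ hg
  · rintro _ ⟨h, x, hx, rfl⟩
    rw [Subregular.mem_coadStabilizer_iff,
      Subregular.mem_coadStabAlgebra_fMat_iff hl₁ hl₂ hγ₁ hγ₂] at hx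
    exact Subregular.conj_mem_closure_zeroSet hγ₁ hγ₂ hx h
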